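/- A \emph{cbba} is a unital $\mathbb{Z}\times\mathbb{Z}$-graded $\mathbb{C}$-algebra $A=\bigoplus_{p,q}A^{p,q}$, graded-commutative with respect to the total degree $p+q$, with differentials $\partial,\bar\partial$ of bidegrees $(1,0)$ and $(0,1)$ that satisfy $\partial^2=\bar\partial^2=\partial\bar\partial+\bar\partial\partial=0$ and the graded Leibniz rule. Morphisms are unital algebra maps that preserve the bigrading and commute with $\partial$ and $\bar\partial$. A morphism is a \emph{weak equivalence} (bigraded quasi-isomorphism) if it induces isomorphisms in Bott--Chern cohomology $H_{BC}=(\ker\partial\cap\ker\bar\partial)/\operatorname{im}\partial\bar\partial$ and in Aeppli cohomology $H_A=\ker\partial\bar\partial/(\operatorname{im}\partial+\operatorname{im}\bar\partial)$. A cbba is \emph{connected} if it is concentrated in non-negative total degrees and the unit $\mathbb{C}\to A^0$ is an isomorphism. An \emph{augmented} cbba is a cbba with a morphism $\varepsilon:A\to\mathbb{C}$; put $A^+=\ker\varepsilon$. It is \emph{nilpotent} if it is a free graded-commutative algebra $\Lambda V$ on a bigraded space $V$ with a well-ordered homogeneous basis such that $\partial$ and $\bar\partial$ of each basis element lie in the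 subalgebra generated by the smaller ones, and \emph{minimal} if moreover $\operatorname{im}\partial\bar\partial\subseteq A^+A^+$. A \emph{minimal model} of a cbba $A$ is a weak equivalence $M\to A$ with $M$ minimal. Let $\Omega=\Lambda\langle t,\partial t,\bar\partial t,\partial\bar\partial t\rangle$ with $|t|=(0,0)$, and for $s\in\mathbb{C}$ let $\varepsilon_s:\Omega\to\mathbb{C}$ send $t$ to $s$ and the other generators to $0$. Two morphisms $f,g:A\to B$ of cbba's are \emph{homotopic}, $f\sim g$, if there is a morphism $H:A\to\Omega\otimes B$ with $(\varepsilon_0\otimes\mathrm{id})H=f$ and $(\varepsilon_1\otimes\mathrm{id})H=g$. For augmented cbba's and augmented morphisms, $H$ is required to be an augmented morphism into $\mathbb{C}\oplus\Omega\otimes B^+$, augmented by the projection to $\mathbb{C}$. \textbf{Theorem.} (1) Any weak equivalence between two connected minimal cbba's is an isomorphism. (2) Consequently, any two connected minimal models of a cbba are isomorphic over it, up to homotopy: if $\varphi:M\to A$ and $\psi:N\to A$ are minimal models of a cbba $A$ with $M$ and $N$ connected, there is an isomorphism of (augmented) cbba's $f:M\to N$ with $\psi\circ f\sim\varphi$.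 If $A$ is augmented and $\varphi,\psi$ are morphisms of augmented cbba's, there is an isomorphism $f$ of augmented cbba's such that $\psi\circ f$ and $\varphi$ are homotopic as morphisms of augmented cbba's. -/

import Mathlib

open scoped TensorProduct

universe u v w

noncomputable section

/-- The sign `(-1)^n` as a complex number. -/
def ksign (n : ℤ) : ℂ := ((n.negOnePow : ℤ) : ℂ)

lemma ksign_even {n : ℤ} (h : Even n) : ksign n = 1 := by simp [ksign, Int.negOnePow_even n h]

lemma ksign_odd {n : ℤ} (h : Odd n) : ksign n = -1 := by simp [ksign, Int.negOnePow_odd n h]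

lemma ksign_add (m n : ℤ) : ksign (m + n) = ksign m * ksign n := by
  simp [ksign, Int.negOnePow_add]

lemma ksign_mul_self (n : ℤ) : ksign n * ksign n = 1 := by
  rcases Int.even_or_odd n with h | h <;> simp [ksign_even, ksign_odd, h]

/-- The total degree `p + q` of a bidegree `(p, q)`. -/
def totalDeg (p : ℤ × ℤ) : ℤ := p.1 + p.2

lemma totalDeg_add (p q : ℤ × ℤ) : totalDeg (p + q) = totalDeg p + totalDeg q := by
  simp only [totalDeg, Prod.fst_add, Prod.snd_add]; ring

/-- A graded-commutative bigraded bidifferential algebra over `ℂ` (cbba): a `ℤ × ℤ`-graded unital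
algebra, graded-commutative for the total degree, with anticommuting differentials `del` and
`delbar` of bidegrees `(1, 0)` and `(0, 1)` that satisfy the graded Leibniz rule. -/
structure CBBA where
  carrier : Type u
  [ring : Ring carrier]
  [algebra : Algebra ℂ carrier]
  /-- The component of bidegree `(p, q)`. -/
  gr : ℤ × ℤ → Submodule ℂ carrier
  gradedMonoid : SetLike.GradedMonoid gr
  isInternal : DirectSum.IsInternal gr
  mul_comm_of_mem : ∀ {p q : ℤ × ℤ} {a b : carrier}, a ∈ gr p → b ∈ gr q →
    a * b = ksign (totalDeg p * totalDeg q) • (b * a)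
  del : carrier →ₗ[ℂ] carrier
  delbar : carrier →ₗ[ℂ] carrier
  del_mem : ∀ {p : ℤ × ℤ} {a : carrier}, a ∈ gr p → del a ∈ gr (p + (1, 0))
  delbar_mem : ∀ {p : ℤ × ℤ} {a : carrier}, a ∈ gr p → delbar a ∈ gr (p + (0, 1))
  del_del : ∀ a, del (del a) = 0
  delbar_delbar : ∀ a, delbar (delbar a) = 0
  del_delbar : ∀ a, del (delbar a) + delbar (del a) = 0
  del_mul : ∀ {p : ℤ × ℤ} {a : carrier} (b : carrier), a ∈ gr p →
    del (a * b) = del a * b + ksign (totalDeg p) • (a * del b)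
  delbar_mul : ∀ {p : ℤ × ℤ} {a : carrier} (b : carrier), a ∈ gr p →
    delbar (a * b) = delbar a * b + ksign (totalDeg p) • (a * delbar b)

namespace CBBA

attribute [instance] CBBA.ring CBBA.algebra CBBA.gradedMonoid

/-- A direct sum decomposition is detected by a coaction. -/
lemma isInternal_of_coaction {ι M : Type*} [DecidableEq ι] [AddCommGroup M] [Module ℂ M]
    (gr : ι → Submodule ℂ M) (c : M →ₗ[ℂ] (ι →₀ M))
    (hc : ∀ i, ∀ x ∈ gr i, c x = Finsupp.single i x) (htop : ∀ x, x ∈ ⨆ i, gr i) :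
    DirectSum.IsInternal gr := by
  refine ⟨?_, ?_⟩
  · have key : ∀ x : DirectSum ι (fun i => gr i), ∀ i,
        c (DirectSum.coeAddMonoidHom gr x) i = (x i : M) := by
      intro x i
      induction x using DirectSum.induction_on with
      | zero => simp
      | of j y =>
        rw [DirectSum.coeAddMonoidHom_of, hc j y y.2, Finsupp.single_apply, DirectSum.coe_of_apply]
        split_ifs <;> rfl
      | add x y hx hy => simp [hx, hy]
    intro x y hxy
    ext i
    rw [← key x i, ← key y i, hxy]
  · intro x
    have := htop x
    rw [Submodule.iSup_eq_range_dfinsupp_lsum] at this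
    obtain ⟨y, hy⟩ := this
    exact ⟨y, hy⟩

section
variable (A : CBBA.{u})

/-- The component `A^k` of total degree `k`, the sum of all `A^{p,q}` with `p + q = k`. -/
def tot (k : ℤ) : Submodule ℂ A.carrier := ⨆ p : {p : ℤ × ℤ // totalDeg p = k}, A.gr p

lemma gr_le_tot (p : ℤ × ℤ) : A.gr p ≤ A.tot (totalDeg p) :=
  le_iSup (fun p' : {p' : ℤ × ℤ // totalDeg p' = totalDeg p} => A.gr p') ⟨p, rfl⟩

lemma iSup_gr (x : A.carrier) : x ∈ ⨆ p, A.gr p := by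
  rw [A.isInternal.submodule_iSup_eq_top]; trivial

lemma bijective_coe : Function.Bijective (DirectSum.coeLinearMap A.gr) := A.isInternal

/-- The linear map that is `f p` on the component of bidegree `p`. -/
def homLift {N : Type*} [AddCommGroup N] [Module ℂ N] (f : ∀ p, A.gr p →ₗ[ℂ] N) :
    A.carrier →ₗ[ℂ] N :=
  DirectSum.toModule ℂ (ℤ × ℤ) N f ∘ₗ
    (LinearEquiv.ofBijective (DirectSum.coeLinearMap A.gr) A.bijective_coe).symm.toLinearMap

lemma homLift_of_mem {N : Type*} [AddCommGroup N] [Module ℂ N] (f : ∀ p, A.gr p →ₗ[ℂ] N)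
    {p : ℤ × ℤ} {a : A.carrier} (ha : a ∈ A.gr p) : A.homLift f a = f p ⟨a, ha⟩ := by
  have : (LinearEquiv.ofBijective (DirectSum.coeLinearMap A.gr) A.bijective_coe).symm a
      = DirectSum.lof ℂ (ℤ × ℤ) (fun p => A.gr p) p ⟨a, ha⟩ := by
    rw [LinearEquiv.symm_apply_eq]
    exact (DirectSum.coeLinearMap_lof A.gr p ⟨a, ha⟩).symm
  simp [homLift, this]

/-- The parity operator `a ↦ (-1)^{|a|} a`. -/
def par : A.carrier →ₗ[ℂ] A.carrier :=
  A.homLift fun p => ksign (totalDeg p) • (A.gr p).subtype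

lemma par_of_mem {p : ℤ × ℤ} {a : A.carrier} (ha : a ∈ A.gr p) :
    A.par a = ksign (totalDeg p) • a := by
  simp [par, A.homLift_of_mem _ ha]

/-- The coaction that records the bidegree. -/
def coact : A.carrier →ₗ[ℂ] (ℤ × ℤ →₀ A.carrier) :=
  A.homLift fun p => Finsupp.lsingle p ∘ₗ (A.gr p).subtype

lemma coact_of_mem {p : ℤ × ℤ} {a : A.carrier} (ha : a ∈ A.gr p) :
    A.coact a = Finsupp.single p a := by
  simp [coact, A.homLift_of_mem _ ha]

/-- Two linear maps that agree on homogeneous elements are equal. -/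
lemma lin_ext {N : Type*} [AddCommGroup N] [Module ℂ N] {f g : A.carrier →ₗ[ℂ] N}
    (h : ∀ p, ∀ a ∈ A.gr p, f a = g a) : f = g := by
  ext x
  have hle : (⨆ p, A.gr p) ≤ LinearMap.eqLocus f g := iSup_le fun p a ha => h p a ha
  exact hle (A.iSup_gr x)

lemma tot_isInternal : DirectSum.IsInternal A.tot := by
  refine isInternal_of_coaction A.tot
    (A.homLift fun p => Finsupp.lsingle (totalDeg p) ∘ₗ (A.gr p).subtype) ?_ ?_
  · intro k x hx
    have hle : A.tot k ≤ LinearMap.eqLocus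
        (A.homLift fun p => Finsupp.lsingle (totalDeg p) ∘ₗ (A.gr p).subtype)
        (Finsupp.lsingle k) := by
      refine iSup_le fun p a ha => ?_
      have := A.homLift_of_mem
        (fun p => Finsupp.lsingle (R := ℂ) (totalDeg p) ∘ₗ (A.gr p).subtype) ha
      simp only [LinearMap.mem_eqLocus, this]
      simp [p.2]
    exact hle hx
  · intro x
    have hle : (⨆ p, A.gr p) ≤ ⨆ k, A.tot k :=
      iSup_le fun p => (A.gr_le_tot p).trans (le_iSup A.tot _)
    exact hle (A.iSup_gr x)

instance tot_gradedMonoid : SetLike.GradedMonoid A.tot where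
  one_mem := A.gr_le_tot 0 SetLike.GradedOne.one_mem
  mul_mem := by
    intro i j a b ha hb
    have h1 : A.tot i ≤ (A.tot (i + j)).comap (LinearMap.mulRight ℂ b) := by
      refine iSup_le fun p a ha => ?_
      have h2 : A.tot j ≤ (A.tot (i + j)).comap (LinearMap.mulLeft ℂ a) := by
        refine iSup_le fun q b hb => ?_
        have := A.gr_le_tot _ (SetLike.GradedMul.mul_mem ha hb)
        rw [totalDeg_add, p.2, q.2] at this
        exact this
      exact h2 hb
    exact h1 ha

/-- The grading by total degree. -/
instance tot_gradedAlgebra : GradedAlgebra A.tot :=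
  { A.tot_gradedMonoid, A.tot_isInternal.chooseDecomposition with }

end

/-! ### Tensor product -/

section tensor
variable (A : CBBA.{u}) (B : CBBA.{v})

/-- The algebra underlying the tensor product, with
`(a ⊗ b) (a' ⊗ b') = (-1)^{|b||a'|} aa' ⊗ bb'`. -/
def TCar : Type (max u v) := GradedTensorProduct ℂ A.tot B.tot

instance : Ring (TCar A B) := inferInstanceAs (Ring (GradedTensorProduct ℂ A.tot B.tot))

instance : Algebra ℂ (TCar A B) :=
  inferInstanceAs (Algebra ℂ (GradedTensorProduct ℂ A.tot B.tot))

/-- The identification of the underlying vector space with the tensor product. -/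
def tof : A.carrier ⊗[ℂ] B.carrier ≃ₗ[ℂ] TCar A B := GradedTensorProduct.of ℂ A.tot B.tot

variable {A B} in
/-- The pure tensor `a ⊗ b`. -/
def tm (a : A.carrier) (b : B.carrier) : TCar A B := tof A B (a ⊗ₜ b)

lemma uzpow_smul {M : Type*} [AddCommGroup M] [Module ℂ M] (n : ℤ) (x : M) :
    ((-1 : ℤˣ) ^ n) • x = ksign n • x := by
  rw [ksign, Int.negOnePow_def, Units.smul_def, ← Int.cast_smul_eq_zsmul ℂ]

variable {A B} in
lemma tm_mul_tm {p q : ℤ × ℤ} (a : A.carrier) {b : B.carrier} (hb : b ∈ B.gr p)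
    {a' : A.carrier} (ha' : a' ∈ A.gr q) (b' : B.carrier) :
    tm a b * tm a' b' = ksign (totalDeg p * totalDeg q) • tm (a * a') (b * b') := by
  have := GradedTensorProduct.tmul_coe_mul_coe_tmul (R := ℂ) A.tot B.tot a
    ⟨b, B.gr_le_tot p hb⟩ ⟨a', A.gr_le_tot q ha'⟩ b'
  rw [← uzpow_smul]
  exact this

/-- The component of bidegree `p` of the tensor product. -/
def tgr (p : ℤ × ℤ) : Submodule ℂ (TCar A B) :=
  Submodule.span ℂ {x | ∃ i j, i + j = p ∧ ∃ a ∈ A.gr i, ∃ b ∈ B.gr j, x = tm a b}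

variable {A B} in
lemma tm_mem {p i j : ℤ × ℤ} (h : i + j = p) {a : A.carrier} (ha : a ∈ A.gr i) {b : B.carrier}
    (hb : b ∈ B.gr j) : tm a b ∈ tgr A B p :=
  Submodule.subset_span ⟨i, j, h, a, ha, b, hb, rfl⟩

/-- Apply a linear map to both tensor factors. -/
def tmap {A' B' : Type*} [AddCommGroup A'] [AddCommGroup B'] [Module ℂ A'] [Module ℂ B']
    (f : A.carrier →ₗ[ℂ] A') (g : B.carrier →ₗ[ℂ] B') : TCar A B →ₗ[ℂ] A' ⊗[ℂ] B' :=
  TensorProduct.map f g ∘ₗ (tof A B).symm.toLinearMap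

variable {A B} in
@[simp] lemma tmap_tm {A' B' : Type*} [AddCommGroup A'] [AddCommGroup B'] [Module ℂ A']
    [Module ℂ B'] (f : A.carrier →ₗ[ℂ] A') (g : B.carrier →ₗ[ℂ] B') (a : A.carrier)
    (b : B.carrier) : tmap A B f g (tm a b) = f a ⊗ₜ g b := by simp [tmap, tm]

/-- `tmap` with values in the graded tensor product. -/
def tend (f : A.carrier →ₗ[ℂ] A.carrier) (g : B.carrier →ₗ[ℂ] B.carrier) :
    TCar A B →ₗ[ℂ] TCar A B :=
  (tof A B).toLinearMap ∘ₗ tmap A B f g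

variable {A B} in
@[simp] lemma tend_tm (f : A.carrier →ₗ[ℂ] A.carrier) (g : B.carrier →ₗ[ℂ] B.carrier)
    (a : A.carrier) (b : B.carrier) : tend A B f g (tm a b) = tm (f a) (g b) := by
  simp only [tend, LinearMap.comp_apply, tmap_tm]; rfl

lemma tm_zero_left (b : B.carrier) : tm (0 : A.carrier) b = 0 := by
  simp [tm]

lemma tm_zero_right (a : A.carrier) : tm a (0 : B.carrier) = 0 := by
  simp [tm]

variable {A B} in
lemma tm_add_left (a a' : A.carrier) (b : B.carrier) : tm (a + a') b = tm a b + tm a' b := by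
  simp [tm, TensorProduct.add_tmul]

variable {A B} in
lemma tm_add_right (a : A.carrier) (b b' : B.carrier) : tm a (b + b') = tm a b + tm a b' := by
  simp [tm, TensorProduct.tmul_add]

variable {A B} in
lemma tm_smul_left (c : ℂ) (a : A.carrier) (b : B.carrier) : tm (c • a) b = c • tm a b := by
  rw [tm, ← TensorProduct.smul_tmul', map_smul, tm]

variable {A B} in
lemma tm_smul_right (c : ℂ) (a : A.carrier) (b : B.carrier) : tm a (c • b) = c • tm a b := by
  simp [tm]

/-- Linear maps on the tensor product that agree on homogeneous pure tensors are equal. -/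
lemma t_ext {N : Type*} [AddCommGroup N] [Module ℂ N] {f g : TCar A B →ₗ[ℂ] N}
    (h : ∀ i, ∀ a ∈ A.gr i, ∀ j, ∀ b ∈ B.gr j, f (tm a b) = g (tm a b)) : f = g := by
  have hfg : f ∘ₗ (tof A B).toLinearMap = g ∘ₗ (tof A B).toLinearMap := by
    apply TensorProduct.ext
    refine A.lin_ext fun i a ha => B.lin_ext fun j b hb => ?_
    exact h i a ha j b hb
  ext x
  simpa using LinearMap.congr_fun hfg ((tof A B).symm x)

/-- The differential `f ⊗ 1 + (-1)^{|·|} ⊗ g`. -/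
def tdiff (f : A.carrier →ₗ[ℂ] A.carrier) (g : B.carrier →ₗ[ℂ] B.carrier) :
    TCar A B →ₗ[ℂ] TCar A B :=
  tend A B f LinearMap.id + tend A B A.par g

variable {A B} in
lemma tdiff_tm (f : A.carrier →ₗ[ℂ] A.carrier) (g : B.carrier →ₗ[ℂ] B.carrier) {i : ℤ × ℤ}
    {a : A.carrier} (ha : a ∈ A.gr i) (b : B.carrier) :
    tdiff A B f g (tm a b) = tm (f a) b + ksign (totalDeg i) • tm a (g b) := by
  simp only [tdiff, LinearMap.add_apply, tend_tm, A.par_of_mem ha, tm_smul_left, LinearMap.id_apply]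

/-- The coaction on the tensor product. -/
def tcoact : TCar A B →ₗ[ℂ] (ℤ × ℤ →₀ TCar A B) :=
  Finsupp.mapRange.linearMap (tof A B).toLinearMap ∘ₗ
    Finsupp.lmapDomain _ ℂ (fun x : (ℤ × ℤ) × (ℤ × ℤ) => x.1 + x.2) ∘ₗ
      (finsuppTensorFinsupp ℂ ℂ A.carrier B.carrier (ℤ × ℤ) (ℤ × ℤ)).toLinearMap ∘ₗ
        tmap A B A.coact B.coact

variable {A B} in
lemma tcoact_tm {i j : ℤ × ℤ} {a : A.carrier} (ha : a ∈ A.gr i) {b : B.carrier}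
    (hb : b ∈ B.gr j) : tcoact A B (tm a b) = Finsupp.single (i + j) (tm a b) := by
  simp [tcoact, tm, tmap, A.coact_of_mem ha, B.coact_of_mem hb, Finsupp.mapDomain_single]

lemma tgr_isInternal : DirectSum.IsInternal (tgr A B) := by
  refine isInternal_of_coaction _ (tcoact A B) ?_ ?_
  · intro p x hx
    have hle : tgr A B p ≤ LinearMap.eqLocus (tcoact A B) (Finsupp.lsingle p) := by
      refine Submodule.span_le.2 ?_
      rintro _ ⟨i, j, rfl, a, ha, b, hb, rfl⟩
      exact tcoact_tm ha hb
    exact hle hx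
  · have h : (⨆ p, tgr A B p).mkQ = 0 := by
      refine t_ext A B fun i a ha j b hb => ?_
      rw [LinearMap.zero_apply, Submodule.mkQ_apply, Submodule.Quotient.mk_eq_zero]
      exact le_iSup (tgr A B) (i + j) (tm_mem rfl ha hb)
    intro x
    rw [← Submodule.Quotient.mk_eq_zero, ← Submodule.mkQ_apply, h, LinearMap.zero_apply]

/-- Induction principle for homogeneous elements of the tensor product. -/
lemma tgr_induction {p : ℤ × ℤ} (S : Submodule ℂ (TCar A B))
    (h : ∀ i j, i + j = p → ∀ a ∈ A.gr i, ∀ b ∈ B.gr j, tm a b ∈ S) : tgr A B p ≤ S := by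
  refine Submodule.span_le.2 ?_
  rintro _ ⟨i, j, rfl, a, ha, b, hb, rfl⟩
  exact h i j rfl a ha b hb

instance tgr_gradedMonoid : SetLike.GradedMonoid (tgr A B) where
  one_mem := tm_mem (zero_add 0) SetLike.GradedOne.one_mem SetLike.GradedOne.one_mem
  mul_mem := by
    intro p q x y hx hy
    refine tgr_induction A B ((tgr A B (p + q)).comap (LinearMap.mulRight ℂ y)) ?_ hx
    intro i j hij a ha b hb
    refine tgr_induction A B ((tgr A B (p + q)).comap (LinearMap.mulLeft ℂ (tm a b))) ?_ hy
    intro i' j' hij' a' ha' b' hb'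
    simp only [Submodule.mem_comap, LinearMap.mulLeft_apply]
    rw [tm_mul_tm a hb ha' b']
    refine Submodule.smul_mem _ _ (tm_mem ?_ (SetLike.GradedMul.mul_mem ha ha')
      (SetLike.GradedMul.mul_mem hb hb'))
    rw [← hij, ← hij']; abel

lemma tgr_comm {p q : ℤ × ℤ} {x y : TCar A B} (hx : x ∈ tgr A B p) (hy : y ∈ tgr A B q) :
    x * y = ksign (totalDeg p * totalDeg q) • (y * x) := by
  refine tgr_induction A B (LinearMap.eqLocus (LinearMap.mulRight ℂ y)
    (ksign (totalDeg p * totalDeg q) • LinearMap.mulLeft ℂ y)) ?_ hx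
  intro i j hij a ha b hb
  refine tgr_induction A B (LinearMap.eqLocus (LinearMap.mulLeft ℂ (tm a b))
    (ksign (totalDeg p * totalDeg q) • LinearMap.mulRight ℂ (tm a b))) ?_ hy
  intro i' j' hij' a' ha' b' hb'
  simp only [LinearMap.mem_eqLocus, LinearMap.mulLeft_apply, LinearMap.smul_apply,
    LinearMap.mulRight_apply]
  rw [tm_mul_tm a hb ha' b', tm_mul_tm a' hb' ha b, A.mul_comm_of_mem ha ha',
    B.mul_comm_of_mem hb hb', tm_smul_left, tm_smul_right, smul_smul, smul_smul, smul_smul]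
  congr 1
  subst hij hij'
  simp only [totalDeg_add, add_mul, mul_add, ksign_add]
  rw [mul_comm (totalDeg j') (totalDeg i)]
  have := ksign_mul_self (totalDeg i * totalDeg j')
  linear_combination (- ksign (totalDeg j * totalDeg i') * ksign (totalDeg i * totalDeg i')
    * ksign (totalDeg j * totalDeg j')) * this

lemma tdiff_mem {f : A.carrier →ₗ[ℂ] A.carrier} {g : B.carrier →ₗ[ℂ] B.carrier} {e : ℤ × ℤ}
    (hf : ∀ {p a}, a ∈ A.gr p → f a ∈ A.gr (p + e))
    (hg : ∀ {p b}, b ∈ B.gr p → g b ∈ B.gr (p + e)) {p : ℤ × ℤ} {x : TCar A B}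
    (hx : x ∈ tgr A B p) : tdiff A B f g x ∈ tgr A B (p + e) := by
  refine tgr_induction A B ((tgr A B (p + e)).comap (tdiff A B f g)) ?_ hx
  intro i j hij a ha b hb
  rw [Submodule.mem_comap, tdiff_tm f g ha]
  exact Submodule.add_mem _ (tm_mem (by rw [← hij]; abel) (hf ha) hb)
    (Submodule.smul_mem _ _ (tm_mem (by rw [← hij]; abel) ha (hg hb)))

lemma tdiff_tdiff {f f' : A.carrier →ₗ[ℂ] A.carrier} {g g' : B.carrier →ₗ[ℂ] B.carrier}
    {e : ℤ × ℤ} (he : totalDeg e = 1) (hf : ∀ {p a}, a ∈ A.gr p → f a ∈ A.gr (p + e))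
    {i : ℤ × ℤ} {a : A.carrier} (ha : a ∈ A.gr i) (b : B.carrier) :
    tdiff A B f' g' (tdiff A B f g (tm a b)) = tm (f' (f a)) b + tm a (g' (g b))
      + ksign (totalDeg i) • (tm (f' a) (g b) - tm (f a) (g' b)) := by
  rw [tdiff_tm f g ha, map_add, map_smul, tdiff_tm f' g' (hf ha), tdiff_tm f' g' ha, totalDeg_add,
    he, ksign_add, ksign_odd odd_one, smul_add, smul_smul, ksign_mul_self]
  module

lemma tdiff_mul {f : A.carrier →ₗ[ℂ] A.carrier} {g : B.carrier →ₗ[ℂ] B.carrier} {e : ℤ × ℤ}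
    (he : totalDeg e = 1) (hf : ∀ {p a}, a ∈ A.gr p → f a ∈ A.gr (p + e))
    (hg : ∀ {p b}, b ∈ B.gr p → g b ∈ B.gr (p + e))
    (hfm : ∀ {p a} (a'), a ∈ A.gr p → f (a * a') = f a * a' + ksign (totalDeg p) • (a * f a'))
    (hgm : ∀ {p b} (b'), b ∈ B.gr p → g (b * b') = g b * b' + ksign (totalDeg p) • (b * g b'))
    {p : ℤ × ℤ} {x : TCar A B} (y : TCar A B) (hx : x ∈ tgr A B p) :
    tdiff A B f g (x * y) = tdiff A B f g x * y + ksign (totalDeg p) • (x * tdiff A B f g y) := by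
  refine tgr_induction A B (LinearMap.eqLocus (tdiff A B f g ∘ₗ LinearMap.mulRight ℂ y)
    (LinearMap.mulRight ℂ y ∘ₗ tdiff A B f g +
      ksign (totalDeg p) • LinearMap.mulRight ℂ (tdiff A B f g y))) ?_ hx
  intro i j hij a ha b hb
  rw [LinearMap.mem_eqLocus]
  have key : tdiff A B f g ∘ₗ LinearMap.mulLeft ℂ (tm a b) =
      LinearMap.mulLeft ℂ (tdiff A B f g (tm a b)) +
        ksign (totalDeg p) • (LinearMap.mulLeft ℂ (tm a b) ∘ₗ tdiff A B f g) := by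
    refine t_ext A B fun i' a' ha' j' b' hb' => ?_
    simp only [LinearMap.comp_apply, LinearMap.mulLeft_apply, LinearMap.add_apply,
      LinearMap.smul_apply]
    rw [tm_mul_tm a hb ha', map_smul, tdiff_tm f g (SetLike.GradedMul.mul_mem ha ha'),
      tdiff_tm f g ha, tdiff_tm f g ha', add_mul, mul_add, smul_mul_assoc, mul_smul_comm,
      tm_mul_tm _ hb ha', tm_mul_tm _ (hg hb) ha', tm_mul_tm _ hb (hf ha'), tm_mul_tm _ hb ha',
      hfm a' ha, hgm b' hb, tm_add_left, tm_add_right, tm_smul_left, tm_smul_right]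
    subst hij
    simp only [totalDeg_add, he, add_mul, mul_add, mul_one, one_mul, ksign_add, smul_add, smul_smul]
    rcases Int.even_or_odd (totalDeg j) with h1 | h1 <;>
    rcases Int.even_or_odd (totalDeg i') with h2 | h2 <;>
    simp only [ksign_even, ksign_odd, h1, h2] <;> module
  exact congrArg (fun φ => φ y) key
end tensor

/-- The tensor product of two cbba's, with `d (a ⊗ b) = da ⊗ b + (-1)^{|a|} a ⊗ db`. -/
def tensor (A : CBBA.{u}) (B : CBBA.{v}) : CBBA.{max u v} where
  carrier := TCar A B
  gr := tgr A B
  gradedMonoid := tgr_gradedMonoid A B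
  isInternal := tgr_isInternal A B
  mul_comm_of_mem := tgr_comm A B
  del := tdiff A B A.del B.del
  delbar := tdiff A B A.delbar B.delbar
  del_mem := tdiff_mem A B A.del_mem B.del_mem
  delbar_mem := tdiff_mem A B A.delbar_mem B.delbar_mem
  del_del := by
    have h : tdiff A B A.del B.del ∘ₗ tdiff A B A.del B.del = 0 := by
      refine t_ext A B fun i a ha j b _ => ?_
      rw [LinearMap.comp_apply, tdiff_tdiff A B (e := (1, 0)) rfl A.del_mem ha, A.del_del,
        B.del_del, tm_zero_left, tm_zero_right]
      simp
    exact fun x => LinearMap.congr_fun h x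
  delbar_delbar := by
    have h : tdiff A B A.delbar B.delbar ∘ₗ tdiff A B A.delbar B.delbar = 0 := by
      refine t_ext A B fun i a ha j b _ => ?_
      rw [LinearMap.comp_apply, tdiff_tdiff A B (e := (0, 1)) rfl A.delbar_mem ha,
        A.delbar_delbar, B.delbar_delbar, tm_zero_left, tm_zero_right]
      simp
    exact fun x => LinearMap.congr_fun h x
  del_delbar := by
    have h : tdiff A B A.del B.del ∘ₗ tdiff A B A.delbar B.delbar +
        tdiff A B A.delbar B.delbar ∘ₗ tdiff A B A.del B.del = 0 := by
      refine t_ext A B fun i a ha j b _ => ?_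
      rw [LinearMap.add_apply, LinearMap.comp_apply, LinearMap.comp_apply,
        tdiff_tdiff A B (e := (0, 1)) rfl A.delbar_mem ha,
        tdiff_tdiff A B (e := (1, 0)) rfl A.del_mem ha,
        eq_neg_of_add_eq_zero_left (A.del_delbar a), eq_neg_of_add_eq_zero_left (B.del_delbar b),
        ← neg_one_smul ℂ (A.delbar (A.del a)), ← neg_one_smul ℂ (B.delbar (B.del b)),
        tm_smul_left, tm_smul_right, LinearMap.zero_apply]
      module
    exact fun x => LinearMap.congr_fun h x
  del_mul := tdiff_mul A B rfl A.del_mem B.del_mem A.del_mul B.del_mul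
  delbar_mul := tdiff_mul A B rfl A.delbar_mem B.delbar_mem A.delbar_mul B.delbar_mul

/-- The base field `ℂ`, concentrated in bidegree `(0, 0)`. -/
def base : CBBA.{0} where
  carrier := ℂ
  gr p := if p = 0 then ⊤ else ⊥
  gradedMonoid :=
    { one_mem := by simp
      mul_mem := by
        intro p q a b ha hb
        by_cases hp : p = 0 <;> by_cases hq : q = 0 <;> simp_all }
  isInternal := by
    refine isInternal_of_coaction _ (Finsupp.lsingle 0) ?_ ?_
    · intro p x hx
      by_cases hp : p = 0 <;> simp_all
    · intro x
      exact le_iSup (fun p : ℤ × ℤ => if p = 0 then (⊤ : Submodule ℂ ℂ) else ⊥) 0 (by simp)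
  mul_comm_of_mem := by
    intro p q a b ha hb
    by_cases hp : p = 0 <;> by_cases hq : q = 0 <;> simp_all [totalDeg, mul_comm, ksign]
  del := 0
  delbar := 0
  del_mem := by simp
  delbar_mem := by simp
  del_del := by simp
  delbar_delbar := by simp
  del_delbar := by simp
  del_mul := by simp
  delbar_mul := by simp

/-! ### Morphisms, cohomology and weak equivalences -/

/-- A morphism of cbba's: a unital algebra map that preserves the bigrading and commutes with both
differentials. -/
structure Hom (A : CBBA.{u}) (B : CBBA.{v}) where
  toAlgHom : A.carrier →ₐ[ℂ] B.carrier
  map_mem : ∀ {p : ℤ × ℤ} {a : A.carrier}, a ∈ A.gr p → toAlgHom a ∈ B.gr p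
  map_del : ∀ a, toAlgHom (A.del a) = B.del (toAlgHom a)
  map_delbar : ∀ a, toAlgHom (A.delbar a) = B.delbar (toAlgHom a)

namespace Hom

variable {A : CBBA.{u}} {B : CBBA.{v}} {C : CBBA.{w}}

instance : CoeFun (Hom A B) fun _ => A.carrier → B.carrier := ⟨fun f => f.toAlgHom⟩

/-- The identity morphism. -/
def id (A : CBBA.{u}) : Hom A A where
  toAlgHom := AlgHom.id ℂ A.carrier
  map_mem h := h
  map_del _ := rfl
  map_delbar _ := rfl

/-- Composition `g ∘ f`. -/
def comp (g : Hom B C) (f : Hom A B) : Hom A C where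
  toAlgHom := g.toAlgHom.comp f.toAlgHom
  map_mem h := g.map_mem (f.map_mem h)
  map_del a := by simp [f.map_del, g.map_del]
  map_delbar a := by simp [f.map_delbar, g.map_delbar]

/-- `f` is an isomorphism of cbba's. -/
def IsIso (f : Hom A B) : Prop :=
  ∃ g : Hom B A, g.comp f = Hom.id A ∧ f.comp g = Hom.id B

end Hom

section cohomology
variable (A : CBBA.{u})

/-- The subspace `ker ∂ ∩ ker ∂̄`. -/
def ZBC : Submodule ℂ A.carrier := LinearMap.ker A.del ⊓ LinearMap.ker A.delbar

/-- The subspace `im ∂∂̄`. -/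
def BBC : Submodule ℂ A.carrier := LinearMap.range (A.del ∘ₗ A.delbar)

/-- The subspace `ker ∂∂̄`. -/
def ZA : Submodule ℂ A.carrier := LinearMap.ker (A.del ∘ₗ A.delbar)

/-- The subspace `im ∂ + im ∂̄`. -/
def BA : Submodule ℂ A.carrier := LinearMap.range A.del ⊔ LinearMap.range A.delbar

/-- Bott--Chern cohomology `(ker ∂ ∩ ker ∂̄) / im ∂∂̄`. -/
abbrev HBC : Type u := A.ZBC ⧸ A.BBC.submoduleOf A.ZBC

/-- Aeppli cohomology `ker ∂∂̄ / (im ∂ + im ∂̄)`. -/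
abbrev HA : Type u := A.ZA ⧸ A.BA.submoduleOf A.ZA

end cohomology

namespace Hom

variable {A : CBBA.{u}} {B : CBBA.{v}} (f : Hom A B)

lemma map_ZBC : ∀ x ∈ A.ZBC, f.toAlgHom.toLinearMap x ∈ B.ZBC := by
  rintro x ⟨h1, h2⟩
  have h1 : A.del x = 0 := h1
  have h2 : A.delbar x = 0 := h2
  exact ⟨by simp [← f.map_del, h1], by simp [← f.map_delbar, h2]⟩

lemma map_BBC : A.BBC ≤ B.BBC.comap f.toAlgHom.toLinearMap := by
  rintro _ ⟨y, rfl⟩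
  exact ⟨f y, by simp [f.map_del, f.map_delbar]⟩

lemma map_ZA : ∀ x ∈ A.ZA, f.toAlgHom.toLinearMap x ∈ B.ZA := by
  intro x h
  have h : A.del (A.delbar x) = 0 := h
  simp [ZA, ← f.map_del, ← f.map_delbar, h]

lemma map_BA : A.BA ≤ B.BA.comap f.toAlgHom.toLinearMap := by
  refine sup_le ?_ ?_
  · rintro _ ⟨y, rfl⟩
    exact Submodule.mem_sup_left ⟨f y, by simp [f.map_del]⟩
  · rintro _ ⟨y, rfl⟩
    exact Submodule.mem_sup_right ⟨f y, by simp [f.map_delbar]⟩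

/-- The map induced on Bott--Chern cohomology. -/
def mapHBC : A.HBC →ₗ[ℂ] B.HBC :=
  Submodule.mapQ _ _ (f.toAlgHom.toLinearMap.restrict f.map_ZBC) fun _ hx => f.map_BBC hx

/-- The map induced on Aeppli cohomology. -/
def mapHA : A.HA →ₗ[ℂ] B.HA :=
  Submodule.mapQ _ _ (f.toAlgHom.toLinearMap.restrict f.map_ZA) fun _ hx => f.map_BA hx

/-- A weak equivalence (bigraded quasi-isomorphism): an isomorphism in Bott--Chern and in Aeppli
cohomology. -/
def IsWeakEquiv : Prop := Function.Bijective f.mapHBC ∧ Function.Bijective f.mapHA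

end Hom

end CBBA

/-! ### Free graded-commutative algebras -/

/-- The relations `x_i x_j = (-1)^{|i||j|} x_j x_i`. -/
inductive FreeGCRel {I : Type u} (δ : I → ℤ × ℤ) : FreeAlgebra ℂ I → FreeAlgebra ℂ I → Prop
  | comm (i j : I) : FreeGCRel δ (FreeAlgebra.ι ℂ i * FreeAlgebra.ι ℂ j)
      (ksign (totalDeg (δ i) * totalDeg (δ j)) • (FreeAlgebra.ι ℂ j * FreeAlgebra.ι ℂ i))

/-- The free graded-commutative `ℂ`-algebra `ΛV` on a bigraded vector space `V` with a basis
indexed by `I`, where `i : I` has bidegree `δ i`. -/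
def FreeGC {I : Type u} (δ : I → ℤ × ℤ) : Type u := RingQuot (FreeGCRel δ)

namespace FreeGC

variable {I : Type u} (δ : I → ℤ × ℤ)

instance : Ring (FreeGC δ) := inferInstanceAs (Ring (RingQuot (FreeGCRel δ)))

instance : Algebra ℂ (FreeGC δ) := inferInstanceAs (Algebra ℂ (RingQuot (FreeGCRel δ)))

/-- The quotient map from the free associative algebra. -/
def mk : FreeAlgebra ℂ I →ₐ[ℂ] FreeGC δ := RingQuot.mkAlgHom ℂ (FreeGCRel δ)

/-- The generators. -/
def gen (i : I) : FreeGC δ := mk δ (FreeAlgebra.ι ℂ i)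

lemma gen_mul_gen (i j : I) :
    gen δ i * gen δ j = ksign (totalDeg (δ i) * totalDeg (δ j)) • (gen δ j * gen δ i) := by
  have := RingQuot.mkAlgHom_rel ℂ (FreeGCRel.comm (δ := δ) i j)
  rw [map_mul, map_smul, map_mul] at this
  exact this

variable {δ} in
/-- The algebra map out of the free graded-commutative algebra with prescribed values on the
generators. -/
def liftAlg {R : Type*} [Ring R] [Algebra ℂ R] (v : I → R)
    (hv : ∀ i j, v i * v j = ksign (totalDeg (δ i) * totalDeg (δ j)) • (v j * v i)) :
    FreeGC δ →ₐ[ℂ] R :=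
  RingQuot.liftAlgHom ℂ ⟨FreeAlgebra.lift ℂ v, by
    rintro _ _ ⟨i, j⟩
    simp only [map_mul, map_smul, FreeAlgebra.lift_ι_apply]
    exact hv i j⟩

variable {δ} in
@[simp] lemma liftAlg_gen {R : Type*} [Ring R] [Algebra ℂ R] (v : I → R)
    (hv : ∀ i j, v i * v j = ksign (totalDeg (δ i) * totalDeg (δ j)) • (v j * v i)) (i : I) :
    liftAlg v hv (gen δ i) = v i := by
  have : liftAlg v hv (gen δ i) = FreeAlgebra.lift ℂ v (FreeAlgebra.ι ℂ i) :=
    RingQuot.liftAlgHom_mkAlgHom_apply ℂ _ _ _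
  rw [this, FreeAlgebra.lift_ι_apply]

variable {δ} in
/-- The algebra map `ΛV → A` with prescribed homogeneous values on the generators. -/
def lift (A : CBBA.{v}) (v : I → A.carrier) (hv : ∀ i, v i ∈ A.gr (δ i)) :
    FreeGC δ →ₐ[ℂ] A.carrier :=
  liftAlg v fun i j => A.mul_comm_of_mem (hv i) (hv j)

/-- The monomial attached to a word in the generators. -/
def mon (l : List I) : FreeGC δ := (l.map (gen δ)).prod

/-- The component of bidegree `p`, spanned by the monomials of bidegree `p`. -/
def gr (p : ℤ × ℤ) : Submodule ℂ (FreeGC δ) :=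
  Submodule.span ℂ {x | ∃ l : List I, (l.map δ).sum = p ∧ x = mon δ l}

lemma mon_mem (l : List I) : mon δ l ∈ gr δ (l.map δ).sum :=
  Submodule.subset_span ⟨l, rfl, rfl⟩

lemma mon_nil : mon δ [] = 1 := rfl

lemma mon_cons (i : I) (l : List I) : mon δ (i :: l) = gen δ i * mon δ l := by simp [mon]

lemma mon_append (l l' : List I) : mon δ (l ++ l') = mon δ l * mon δ l' := by simp [mon]

lemma gen_mem (i : I) : gen δ i ∈ gr δ (δ i) := by
  have := mon_mem δ [i]
  simpa [mon] using this

lemma gr_le {p : ℤ × ℤ} (S : Submodule ℂ (FreeGC δ))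
    (h : ∀ l : List I, (l.map δ).sum = p → mon δ l ∈ S) : gr δ p ≤ S := by
  refine Submodule.span_le.2 ?_
  rintro _ ⟨l, hl, rfl⟩
  exact h l hl

instance gr_gradedMonoid : SetLike.GradedMonoid (gr δ) where
  one_mem := mon_mem δ []
  mul_mem := by
    intro p q x y hx hy
    refine gr_le δ ((gr δ (p + q)).comap (LinearMap.mulRight ℂ y)) (fun l hl => ?_) hx
    refine gr_le δ ((gr δ (p + q)).comap (LinearMap.mulLeft ℂ (mon δ l))) (fun l' hl' => ?_) hy
    simp only [Submodule.mem_comap, LinearMap.mulLeft_apply]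
    rw [← mon_append, ← hl, ← hl', ← List.sum_append, ← List.map_append]
    exact mon_mem δ _

/-- The monomials span. -/
lemma span_mon (x : FreeGC δ) : x ∈ Submodule.span ℂ (Set.range (mon δ)) := by
  obtain ⟨y, rfl⟩ : ∃ y, mk δ y = x := RingQuot.mkAlgHom_surjective ℂ (FreeGCRel δ) x
  induction y using FreeAlgebra.induction with
  | grade0 r =>
    rw [AlgHom.commutes, Algebra.algebraMap_eq_smul_one]
    exact Submodule.smul_mem _ _ (Submodule.subset_span ⟨[], rfl⟩)
  | grade1 i => exact Submodule.subset_span ⟨[i], by simp [mon, gen]⟩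
  | mul a b ha hb =>
    rw [map_mul]
    have h : Submodule.span ℂ (Set.range (mon δ)) * Submodule.span ℂ (Set.range (mon δ)) ≤
        Submodule.span ℂ (Set.range (mon δ)) := by
      rw [Submodule.span_mul_span]
      refine Submodule.span_mono ?_
      rintro _ ⟨_, ⟨l, rfl⟩, _, ⟨l', rfl⟩, rfl⟩
      exact ⟨l ++ l', mon_append δ l l'⟩
    exact h (Submodule.mul_mem_mul ha hb)
  | add a b ha hb => rw [map_add]; exact Submodule.add_mem _ ha hb

lemma lin_ext {N : Type*} [AddCommGroup N] [Module ℂ N] {f g : FreeGC δ →ₗ[ℂ] N}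
    (h : ∀ l, f (mon δ l) = g (mon δ l)) : f = g := by
  ext x
  have hle : Submodule.span ℂ (Set.range (mon δ)) ≤ LinearMap.eqLocus f g := by
    refine Submodule.span_le.2 ?_
    rintro _ ⟨l, rfl⟩
    exact h l
  exact hle (span_mon δ x)

/-- The coaction `x_i ↦ x_i T^{δ i}`. -/
def coact : FreeGC δ →ₐ[ℂ] AddMonoidAlgebra (FreeGC δ) (ℤ × ℤ) :=
  liftAlg (fun i => AddMonoidAlgebra.single (δ i) (gen δ i)) fun i j => by
    rw [AddMonoidAlgebra.single_mul_single, AddMonoidAlgebra.single_mul_single, gen_mul_gen,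
      add_comm (δ i), AddMonoidAlgebra.smul_single]

lemma coact_mon (l : List I) :
    coact δ (mon δ l) = AddMonoidAlgebra.single (l.map δ).sum (mon δ l) := by
  induction l with
  | nil => simp [mon, AddMonoidAlgebra.one_def]
  | cons i l ih =>
    rw [mon_cons, map_mul, ih, coact, liftAlg_gen, AddMonoidAlgebra.single_mul_single]
    simp

lemma gr_isInternal : DirectSum.IsInternal (gr δ) := by
  refine CBBA.isInternal_of_coaction _
    ((AddMonoidAlgebra.coeffLinearEquiv ℂ).toLinearMap ∘ₗ (coact δ).toLinearMap) ?_ ?_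
  · intro p x hx
    refine gr_le δ (LinearMap.eqLocus _ (Finsupp.lsingle p)) (fun l hl => ?_) hx
    simp [LinearMap.mem_eqLocus, coact_mon, hl]
  · intro x
    have hle : Submodule.span ℂ (Set.range (mon δ)) ≤ ⨆ p, gr δ p := by
      refine Submodule.span_le.2 ?_
      rintro _ ⟨l, rfl⟩
      exact le_iSup (gr δ) _ (mon_mem δ l)
    exact hle (span_mon δ x)

lemma gen_mul_mon (i : I) (l : List I) : gen δ i * mon δ l =
    ksign (totalDeg (δ i) * totalDeg (l.map δ).sum) • (mon δ l * gen δ i) := by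
  induction l with
  | nil => simp [mon, totalDeg, ksign]
  | cons j l ih =>
    rw [mon_cons, ← mul_assoc, gen_mul_gen, smul_mul_assoc, mul_assoc, ih, mul_smul_comm, smul_smul,
      List.map_cons, List.sum_cons, totalDeg_add, mul_add, ksign_add, mul_assoc]

lemma gr_comm {p q : ℤ × ℤ} {a b : FreeGC δ} (ha : a ∈ gr δ p) (hb : b ∈ gr δ q) :
    a * b = ksign (totalDeg p * totalDeg q) • (b * a) := by
  refine gr_le δ (LinearMap.eqLocus (LinearMap.mulRight ℂ b)
    (ksign (totalDeg p * totalDeg q) • LinearMap.mulLeft ℂ b)) (fun l hl => ?_) ha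
  refine gr_le δ (LinearMap.eqLocus (LinearMap.mulLeft ℂ (mon δ l))
    (ksign (totalDeg p * totalDeg q) • LinearMap.mulRight ℂ (mon δ l))) (fun l' hl' => ?_) hb
  simp only [LinearMap.mem_eqLocus, LinearMap.mulLeft_apply, LinearMap.smul_apply,
    LinearMap.mulRight_apply]
  subst hl hl'
  clear ha hb
  induction l with
  | nil => simp [mon, totalDeg, ksign]
  | cons i l ih =>
    rw [mon_cons, mul_assoc, ih, mul_smul_comm, ← mul_assoc, gen_mul_mon, smul_mul_assoc, smul_smul,
      List.map_cons, List.sum_cons, totalDeg_add, add_mul, ksign_add, mul_assoc,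
      mul_comm (ksign _)]

variable {δ} in
lemma matrix_comm {x : I → FreeGC δ} {e : ℤ × ℤ} (he : totalDeg e = 1)
    (hx : ∀ i, x i ∈ gr δ (δ i + e)) (i j : I) :
    !![ksign (totalDeg (δ i)) • gen δ i, x i; 0, gen δ i] *
        !![ksign (totalDeg (δ j)) • gen δ j, x j; 0, gen δ j] =
      ksign (totalDeg (δ i) * totalDeg (δ j)) •
        (!![ksign (totalDeg (δ j)) • gen δ j, x j; 0, gen δ j] *
          !![ksign (totalDeg (δ i)) • gen δ i, x i; 0, gen δ i]) := by
  have h1 := gr_comm δ (gen_mem δ i) (hx j)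
  have h2 := gr_comm δ (hx i) (gen_mem δ j)
  rw [totalDeg_add, he, mul_add, mul_one, ksign_add] at h1
  rw [totalDeg_add, he, add_mul, one_mul, ksign_add] at h2
  ext a b
  fin_cases a <;> fin_cases b
  · simp [Matrix.mul_apply, Fin.sum_univ_two, gen_mul_gen δ i j, smul_smul]
    ring_nf
  · rcases Int.even_or_odd (totalDeg (δ i)) with k1 | k1 <;>
    rcases Int.even_or_odd (totalDeg (δ j)) with k2 | k2 <;>
    simp [Matrix.mul_apply, Fin.sum_univ_two, h1, h2, ksign_even, ksign_odd, k1, k2] <;>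
    abel
  · simp [Matrix.mul_apply, Fin.sum_univ_two]
  · simp [Matrix.mul_apply, Fin.sum_univ_two, gen_mul_gen δ i j]

variable {δ} in
/-- The algebra map `a ↦ ((-1)^{|a|} a, D a; 0, a)` for the odd derivation `D` with values `x i` on
the generators. -/
def derMat (x : I → FreeGC δ) {e : ℤ × ℤ} (he : totalDeg e = 1)
    (hx : ∀ i, x i ∈ gr δ (δ i + e)) : FreeGC δ →ₐ[ℂ] Matrix (Fin 2) (Fin 2) (FreeGC δ) :=
  liftAlg (fun i => !![ksign (totalDeg (δ i)) • gen δ i, x i; 0, gen δ i]) (matrix_comm he hx)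

variable {δ} in
/-- The odd derivation with values `x i` on the generators. -/
def der (x : I → FreeGC δ) {e : ℤ × ℤ} (he : totalDeg e = 1)
    (hx : ∀ i, x i ∈ gr δ (δ i + e)) : FreeGC δ →ₗ[ℂ] FreeGC δ where
  toFun a := derMat x he hx a 0 1
  map_add' := by simp
  map_smul' := by simp

section
variable {δ}
variable {x : I → FreeGC δ} {e : ℤ × ℤ} (he : totalDeg e = 1) (hx : ∀ i, x i ∈ gr δ (δ i + e))

lemma derMat_mon (l : List I) : derMat x he hx (mon δ l) =
    !![ksign (totalDeg (l.map δ).sum) • mon δ l, der x he hx (mon δ l); 0, mon δ l] := by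
  induction l with
  | nil =>
    have h : der x he hx (mon δ []) = 0 := by simp [der, mon]
    rw [h]
    ext a b
    fin_cases a <;> fin_cases b <;> simp [mon, totalDeg, ksign]
  | cons i l ih =>
    have h : derMat x he hx (mon δ (i :: l)) =
        !![ksign (totalDeg (δ i)) • gen δ i, x i; 0, gen δ i] * derMat x he hx (mon δ l) := by
      rw [mon_cons, map_mul, derMat, liftAlg_gen]
    have h' : der x he hx (mon δ (i :: l)) = derMat x he hx (mon δ (i :: l)) 0 1 := rfl
    rw [h', h, ih]
    ext a b
    fin_cases a <;> fin_cases b <;>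
      simp [Matrix.mul_apply, Fin.sum_univ_two, mon_cons, totalDeg_add, ksign_add, smul_smul,
        mul_comm]

lemma derMat_of_mem {p : ℤ × ℤ} {a : FreeGC δ} (ha : a ∈ gr δ p) : derMat x he hx a =
    !![ksign (totalDeg p) • a, der x he hx a; 0, a] := by
  have h00 : derMat x he hx a 0 0 = ksign (totalDeg p) • a := by
    refine gr_le δ (LinearMap.eqLocus
      (Matrix.entryLinearMap ℂ (FreeGC δ) 0 0 ∘ₗ (derMat x he hx).toLinearMap)
      (ksign (totalDeg p) • LinearMap.id)) (fun l hl => ?_) ha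
    simp [LinearMap.mem_eqLocus, derMat_mon, hl]
  have h10 : derMat x he hx a 1 0 = 0 := by
    refine gr_le δ (LinearMap.eqLocus
      (Matrix.entryLinearMap ℂ (FreeGC δ) 1 0 ∘ₗ (derMat x he hx).toLinearMap)
      0) (fun l hl => ?_) ha
    simp [LinearMap.mem_eqLocus, derMat_mon]
  have h11 : derMat x he hx a 1 1 = a := by
    refine gr_le δ (LinearMap.eqLocus
      (Matrix.entryLinearMap ℂ (FreeGC δ) 1 1 ∘ₗ (derMat x he hx).toLinearMap)
      LinearMap.id) (fun l hl => ?_) ha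
    simp [LinearMap.mem_eqLocus, derMat_mon]
  ext i j
  fin_cases i <;> fin_cases j
  · exact h00
  · rfl
  · exact h10
  · exact h11

lemma der_gen (i : I) : der x he hx (gen δ i) = x i := by
  simp [der, derMat]

lemma der_one : der x he hx 1 = 0 := by
  simp [der]

lemma derMat_apply_one_one (a : FreeGC δ) : derMat x he hx a 1 1 = a := by
  have h : Matrix.entryLinearMap ℂ (FreeGC δ) 1 1 ∘ₗ (derMat x he hx).toLinearMap =
      LinearMap.id := lin_ext δ fun l => by simp [derMat_mon]
  exact LinearMap.congr_fun h a

lemma der_mul {p : ℤ × ℤ} {a : FreeGC δ} (b : FreeGC δ) (ha : a ∈ gr δ p) :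
    der x he hx (a * b) = der x he hx a * b + ksign (totalDeg p) • (a * der x he hx b) := by
  have h : der x he hx (a * b) = derMat x he hx (a * b) 0 1 := rfl
  rw [h, map_mul, derMat_of_mem he hx ha, Matrix.mul_apply, Fin.sum_univ_two,
    derMat_apply_one_one]
  have h' : derMat x he hx b 0 1 = der x he hx b := rfl
  rw [h']
  simp [add_comm]

lemma der_mem {p : ℤ × ℤ} {a : FreeGC δ} (ha : a ∈ gr δ p) : der x he hx a ∈ gr δ (p + e) := by
  refine gr_le δ ((gr δ (p + e)).comap (der x he hx)) (fun l hl => ?_) ha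
  rw [Submodule.mem_comap]
  subst hl
  clear ha
  induction l with
  | nil => rw [mon_nil, der_one]; exact Submodule.zero_mem _
  | cons i l ih =>
    rw [mon_cons, der_mul he hx _ (gen_mem δ i), der_gen, List.map_cons, List.sum_cons]
    refine Submodule.add_mem _ ?_ (Submodule.smul_mem _ _ ?_)
    · have := SetLike.GradedMul.mul_mem (hx i) (mon_mem δ l)
      convert! this using 2
      abel
    · rw [add_assoc]
      exact SetLike.GradedMul.mul_mem (gen_mem δ i) ih

lemma der_anticomm {y : I → FreeGC δ} {e' : ℤ × ℤ} (he' : totalDeg e' = 1)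
    (hy : ∀ i, y i ∈ gr δ (δ i + e'))
    (h : ∀ i, der x he hx (y i) + der y he' hy (x i) = 0) (a : FreeGC δ) :
    der x he hx (der y he' hy a) + der y he' hy (der x he hx a) = 0 := by
  have key : der x he hx ∘ₗ der y he' hy + der y he' hy ∘ₗ der x he hx = 0 := by
    refine lin_ext δ fun l => ?_
    induction l with
    | nil => simp [mon_nil, der_one]
    | cons i l ih =>
      simp only [LinearMap.add_apply, LinearMap.comp_apply, LinearMap.zero_apply] at ih ⊢
      rw [mon_cons, der_mul he hx _ (gen_mem δ i), der_mul he' hy _ (gen_mem δ i), map_add, map_add,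
        map_smul, map_smul, der_gen, der_gen, der_mul he hx _ (hy i), der_mul he' hy _ (hx i),
        der_mul he hx _ (gen_mem δ i), der_mul he' hy _ (gen_mem δ i), der_gen, der_gen,
        totalDeg_add, totalDeg_add, he, he', ksign_add, ksign_odd odd_one,
        eq_neg_of_add_eq_zero_left ih, eq_neg_of_add_eq_zero_left (h i)]
      simp only [neg_mul, mul_neg]
      module
  exact LinearMap.congr_fun key a

lemma der_der (h : ∀ i, der x he hx (x i) = 0) (a : FreeGC δ) :
    der x he hx (der x he hx a) = 0 := by
  have := der_anticomm he hx he hx (fun i => by rw [h i, add_zero]) a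
  rw [← two_smul ℂ] at this
  exact (smul_eq_zero.1 this).resolve_left two_ne_zero

end
end FreeGC

/-! ### The algebra `Ω = Λ⟨t, ∂t, ∂̄t, ∂∂̄t⟩` -/

/-- The generators `t, ∂t, ∂̄t, ∂∂̄t`. -/
inductive PathGen : Type
  | t | dt | dbt | ddbt

namespace PathGen

/-- The bidegrees of the generators, with `|t| = (0, 0)`. -/
def bideg : PathGen → ℤ × ℤ
  | t => (0, 0)
  | dt => (1, 0)
  | dbt => (0, 1)
  | ddbt => (1, 1)

/-- The values of `∂` on the generators. -/
def delGen : PathGen → FreeGC bideg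
  | t => FreeGC.gen bideg dt
  | dt => 0
  | dbt => FreeGC.gen bideg ddbt
  | ddbt => 0

/-- The values of `∂̄` on the generators; note that `∂̄∂t = -∂∂̄t`. -/
def delbarGen : PathGen → FreeGC bideg
  | t => FreeGC.gen bideg dbt
  | dt => - FreeGC.gen bideg ddbt
  | dbt => 0
  | ddbt => 0

lemma delGen_mem (i : PathGen) : delGen i ∈ FreeGC.gr bideg (bideg i + (1, 0)) := by
  cases i
  · exact FreeGC.gen_mem bideg dt
  · exact Submodule.zero_mem _
  · exact FreeGC.gen_mem bideg ddbt
  · exact Submodule.zero_mem _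

lemma delbarGen_mem (i : PathGen) : delbarGen i ∈ FreeGC.gr bideg (bideg i + (0, 1)) := by
  cases i
  · exact FreeGC.gen_mem bideg dbt
  · exact Submodule.neg_mem _ (FreeGC.gen_mem bideg ddbt)
  · exact Submodule.zero_mem _
  · exact Submodule.zero_mem _

end PathGen

open PathGen in
/-- The cbba `Ω = Λ⟨t, ∂t, ∂̄t, ∂∂̄t⟩` with `|t| = (0, 0)`. -/
def Omega : CBBA.{0} where
  carrier := FreeGC bideg
  gr := FreeGC.gr bideg
  gradedMonoid := FreeGC.gr_gradedMonoid bideg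
  isInternal := FreeGC.gr_isInternal bideg
  mul_comm_of_mem := FreeGC.gr_comm bideg
  del := FreeGC.der (e := (1, 0)) delGen rfl delGen_mem
  delbar := FreeGC.der (e := (0, 1)) delbarGen rfl delbarGen_mem
  del_mem := FreeGC.der_mem rfl delGen_mem
  delbar_mem := FreeGC.der_mem rfl delbarGen_mem
  del_del := FreeGC.der_der rfl delGen_mem fun i => by
    cases i
    · exact FreeGC.der_gen rfl delGen_mem dt
    · exact map_zero _
    · exact FreeGC.der_gen rfl delGen_mem ddbt
    · exact map_zero _
  delbar_delbar := FreeGC.der_der rfl delbarGen_mem fun i => by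
    cases i
    · exact FreeGC.der_gen rfl delbarGen_mem dbt
    · exact (map_neg _ _).trans (neg_eq_zero.2 (FreeGC.der_gen rfl delbarGen_mem ddbt))
    · exact map_zero _
    · exact map_zero _
  del_delbar := FreeGC.der_anticomm rfl delGen_mem rfl delbarGen_mem fun i => by
    have h1 := FreeGC.der_gen (e := (1, 0)) rfl delGen_mem
    have h2 := FreeGC.der_gen (e := (0, 1)) rfl delbarGen_mem
    cases i
    · exact (congrArg₂ (· + ·) (h1 dbt) (h2 dt)).trans (add_neg_cancel _)
    · exact (congrArg₂ (· + ·) ((map_neg _ _).trans (neg_eq_zero.2 (h1 ddbt)))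
        (map_zero _)).trans (add_zero _)
    · exact (congrArg₂ (· + ·) (map_zero _) (h2 ddbt)).trans (add_zero _)
    · exact (congrArg₂ (· + ·) (map_zero _) (map_zero _)).trans (add_zero _)
  del_mul := FreeGC.der_mul rfl delGen_mem
  delbar_mul := FreeGC.der_mul rfl delbarGen_mem

/-- The evaluation `Ω → ℂ` that sends `t` to `s` and the other generators to `0`. -/
def Omega.eval (s : ℂ) : Omega.carrier →ₐ[ℂ] ℂ :=
  FreeGC.liftAlg (δ := PathGen.bideg) (fun | .t => s | _ => 0) fun i j => by
    cases i <;> cases j <;> simp [PathGen.bideg, totalDeg, ksign]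

/-! ### Homotopy -/

namespace CBBA

/-- The evaluation `Ω ⊗ B → B` at `s`, i.e. `ω ⊗ b ↦ ω(s) b`. -/
def evalTensor (B : CBBA.{u}) (s : ℂ) : (tensor Omega B).carrier →ₗ[ℂ] B.carrier :=
  (TensorProduct.lid ℂ B.carrier).toLinearMap ∘ₗ
    tmap Omega B (Omega.eval s).toLinearMap LinearMap.id

lemma evalTensor_tm (B : CBBA.{u}) (s : ℂ) (ω : Omega.carrier) (b : B.carrier) :
    B.evalTensor s (tm ω b) = Omega.eval s ω • b :=
  (congrArg (TensorProduct.lid ℂ B.carrier) (tmap_tm _ _ ω b)).trans (TensorProduct.lid_tmul _ _)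

/-- Two morphisms `f, g : A → B` are homotopic if there is a morphism `H : A → Ω ⊗ B` that
evaluates to `f` at `t = 0` and to `g` at `t = 1`. -/
def Homotopic {A : CBBA.{u}} {B : CBBA.{v}} (f g : Hom A B) : Prop :=
  ∃ H : Hom A (tensor Omega B),
    (∀ a, B.evalTensor 0 (H a) = f a) ∧ (∀ a, B.evalTensor 1 (H a) = g a)

/-- `A` is connected: it is concentrated in nonnegative total degrees and the unit `ℂ → A^0` is an
isomorphism. -/
def IsConnected (A : CBBA.{u}) : Prop :=
  (∀ k < 0, A.tot k = ⊥) ∧ Function.Injective (algebraMap ℂ A.carrier) ∧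
    LinearMap.range (Algebra.linearMap ℂ A.carrier) = A.tot 0

/-- `A` is nilpotent: it is free as a bigraded graded-commutative algebra, on a well-ordered basis
of homogeneous generators such that the differentials of each generator lie in the subalgebra
generated by the smaller ones. -/
def IsNilpotent (A : CBBA.{u}) : Prop :=
  ∃ (I : Type u) (_ : LinearOrder I) (_ : WellFoundedLT I) (δ : I → ℤ × ℤ) (x : I → A.carrier)
    (hx : ∀ i, x i ∈ A.gr (δ i)), Function.Bijective (FreeGC.lift A x hx) ∧
      ∀ i, A.del (x i) ∈ Algebra.adjoin ℂ (x '' Set.Iio i) ∧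
        A.delbar (x i) ∈ Algebra.adjoin ℂ (x '' Set.Iio i)

end CBBA

/-- An augmented cbba: a cbba `A` with a morphism of cbba's `A → ℂ`. -/
structure AugCBBA extends CBBA.{u} where
  aug : CBBA.Hom toCBBA CBBA.base

namespace AugCBBA

/-- The augmentation ideal `A⁺ = ker ε`. -/
def augIdeal (A : AugCBBA.{u}) : Submodule ℂ A.carrier :=
  LinearMap.ker A.aug.toAlgHom.toLinearMap

/-- `A` is minimal: it is nilpotent and `im ∂∂̄ ⊆ A⁺A⁺`. -/
def IsMinimal (A : AugCBBA.{u}) : Prop :=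
  A.IsNilpotent ∧ LinearMap.range (A.del ∘ₗ A.delbar) ≤ A.augIdeal * A.augIdeal

/-- The morphism `f` is compatible with the augmentations. -/
def IsAugHom {A : AugCBBA.{u}} {B : AugCBBA.{v}} (f : CBBA.Hom A.toCBBA B.toCBBA) : Prop :=
  B.aug.comp f = A.aug

/-- Homotopy of morphisms of augmented cbba's: as for cbba's, but `H` is required to be a morphism
of augmented cbba's into the subalgebra `ℂ ⊕ Ω ⊗ B⁺` of `Ω ⊗ B`, augmented by the projection to
`ℂ`; equivalently, `H` maps `A⁺` into `Ω ⊗ B⁺`. -/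
def AugHomotopic {A : AugCBBA.{u}} {B : AugCBBA.{v}} (f g : CBBA.Hom A.toCBBA B.toCBBA) : Prop :=
  ∃ H : CBBA.Hom A.toCBBA (CBBA.tensor Omega B.toCBBA),
    (∀ a, B.evalTensor 0 (H a) = f a) ∧ (∀ a, B.evalTensor 1 (H a) = g a) ∧
      ∀ a ∈ A.augIdeal, H a ∈ Submodule.span ℂ
        {x | ∃ ω : Omega.carrier, ∃ b ∈ B.augIdeal, x = CBBA.tm ω b}

/-- `φ : M → A` is a minimal model of the cbba `A`. -/
def IsMinimalModel (M : AugCBBA.{u}) {A : CBBA.{v}} (φ : CBBA.Hom M.toCBBA A) : Prop :=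
  M.IsMinimal ∧ φ.IsWeakEquiv

end AugCBBA

end

noncomputable section

/-! The core is `surjective_of_isWeakEquiv`: a weak equivalence `f : A → B` onto a connected minimal
`B` is surjective. Lift the identity of `B` through `f` up to an augmented homotopy: this gives `g :
B → A` and a homotopy from `u = f ∘ g` to the identity. Integrating the homotopy over `Ω` yields a
linear map `κ` with `id - u = ∂∂̄κ - ∂κ∂̄ + ∂̄κ∂ + κ∂∂̄`, and `κ`, `∂`, `∂̄` preserve `I²`, where `I
= B⁺`. Minimality puts every value of `∂∂̄` in `I²`. Hence `e = id - u` satisfies `∂e ≡ ∂̄e ≡ 0` and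
then `e² ≡ 0` modulo `I²`, so `b ≡ u(b + e b)` and `I ⊆ u(I) + I²`. A Nakayama argument
(`le_sup_pow`) gives `I ⊆ im f + I^(k+1)` for all `k`. Connectedness puts `I^(k+1)` in total degrees
at least `k + 1`, so every bidegree is covered.

For (1), `f` is thus a surjective weak equivalence, its kernel is acyclic, and the identity of `B`
lifts strictly to a section `g`. By two-out-of-three `g` is a weak equivalence into the connected
minimal `A`, hence surjective, which makes `f` injective. For (2), lift `φ` through `ψ` up to
homotopy. Homotopic morphisms agree in cohomology, so the lift is a weak equivalence, and (1)
applies.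

Two tools support this. `exists_lift` extends a lift generator by generator along a nilpotent cbba;
the obstruction at each generator vanishes by acyclicity. `exists_homotopy_lift` applies it to the
path fibration of `ψ`, whose kernel is acyclic because `Ω` contracts onto its constants
(`Omega.exists_contraction`). Throughout, a weak equivalence is used only through injectivity in
Bott--Chern and surjectivity in Aeppli cohomology, except when two-out-of-three is invoked. The
homotopies live in a subalgebra `W` of `Ω ⊗ A`, either everything or `ℂ ⊕ Ω ⊗ A⁺`, so that the plain
and augmented versions share one proof. -/

/-- Well-founded recursion for a choice that has to satisfy a relation depending on the earlier
choices. -/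
lemma exists_forall_of_wellFounded {I X : Type*} [Nonempty X] (r : I → I → Prop)
    (hr : WellFounded r) (R : I → (I → X) → X → Prop)
    (hcongr : ∀ i v v' y, (∀ j, r j i → v j = v' j) → R i v y → R i v' y)
    (hex : ∀ i v, (∀ j, r j i → R j v (v j)) → ∃ y, R i v y) :
    ∃ v : I → X, ∀ i, R i v (v i) := by
  classical
  -- Only values below `i` are available here, so the others are filled in arbitrarily; `hcongr`
  -- makes this harmless. `epsilon` is needed because a valid choice is known to exist only once the
  -- earlier choices are known to be valid.
  let F : ∀ i, (∀ j, r j i → X) → X := fun i v =>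
    Classical.epsilon fun y => R i (fun j => if h : r j i then v j h else Classical.ofNonempty) y
  let v : I → X := hr.fix F
  refine ⟨v, fun i => hr.induction (C := fun i => R i v (v i)) i fun i ih => ?_⟩
  obtain ⟨y, hy⟩ := hex i v ih
  have hv : v i = F i fun j _ => v j := hr.fix_eq F i
  have h : R i (fun j => if r j i then v j else Classical.ofNonempty) (v i) := by
    rw [hv]
    refine Classical.epsilon_spec (p := fun y => R i _ y) ⟨y, hcongr i v _ y (fun j hj => ?_) hy⟩
    simp [hj]
  exact hcongr i _ v _ (fun j hj => by simp [hj]) h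

namespace CBBA

/-! ### Homogeneous components and parity -/

section component
variable (A : CBBA.{u}) {B : CBBA.{v}}

/-- The projection to the component of bidegree `q`. -/
def component (q : ℤ × ℤ) : A.carrier →ₗ[ℂ] A.carrier := Finsupp.lapply q ∘ₗ A.coact

lemma component_of_mem {q : ℤ × ℤ} {a : A.carrier} (ha : a ∈ A.gr q) : A.component q a = a := by
  simp [component, A.coact_of_mem ha]

lemma component_of_mem_of_ne {p q : ℤ × ℤ} {a : A.carrier} (ha : a ∈ A.gr p) (h : p ≠ q) :
    A.component q a = 0 := by
  simp [component, A.coact_of_mem ha, h]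

lemma component_mem (q : ℤ × ℤ) (a : A.carrier) : A.component q a ∈ A.gr q := by
  have h : (A.gr q).mkQ ∘ₗ A.component q = 0 := by
    refine A.lin_ext fun p a ha => ?_
    rw [LinearMap.comp_apply, LinearMap.zero_apply, Submodule.mkQ_apply,
      Submodule.Quotient.mk_eq_zero]
    by_cases hpq : p = q
    · subst hpq; rwa [A.component_of_mem ha]
    · rw [A.component_of_mem_of_ne ha hpq]; exact Submodule.zero_mem _
  have := LinearMap.congr_fun h a
  rwa [LinearMap.comp_apply, LinearMap.zero_apply, Submodule.mkQ_apply,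
    Submodule.Quotient.mk_eq_zero] at this

lemma sum_component (a : A.carrier) : ∑ q ∈ (A.coact a).support, A.component q a = a := by
  have h : Finsupp.lsum ℂ (fun _ => LinearMap.id) ∘ₗ A.coact = LinearMap.id (R := ℂ) :=
    A.lin_ext fun p a ha => by simp [A.coact_of_mem ha]
  exact LinearMap.congr_fun h a

/-- An element lies in a submodule if all its homogeneous components do. -/
lemma mem_of_component_mem (S : Submodule ℂ A.carrier) {a : A.carrier}
    (h : ∀ q, A.component q a ∈ S) : a ∈ S := by
  rw [← A.sum_component a]
  exact Submodule.sum_mem _ fun q _ => h q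

variable {A}

lemma component_comm {e : ℤ × ℤ} {f : A.carrier →ₗ[ℂ] B.carrier}
    (hf : ∀ {p a}, a ∈ A.gr p → f a ∈ B.gr (p + e)) (q : ℤ × ℤ) (a : A.carrier) :
    B.component (q + e) (f a) = f (A.component q a) := by
  have h : B.component (q + e) ∘ₗ f = f ∘ₗ A.component q := by
    refine A.lin_ext fun p a ha => ?_
    rw [LinearMap.comp_apply, LinearMap.comp_apply]
    by_cases hpq : p = q
    · subst hpq; rw [A.component_of_mem ha, B.component_of_mem (hf ha)]
    · rw [A.component_of_mem_of_ne ha hpq, map_zero,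
        B.component_of_mem_of_ne (hf ha) (by simpa using hpq)]
  exact LinearMap.congr_fun h a

lemma component_del (q : ℤ × ℤ) (a : A.carrier) :
    A.component (q + (1, 0)) (A.del a) = A.del (A.component q a) :=
  component_comm A.del_mem q a

lemma component_delbar (q : ℤ × ℤ) (a : A.carrier) :
    A.component (q + (0, 1)) (A.delbar a) = A.delbar (A.component q a) :=
  component_comm A.delbar_mem q a

lemma Hom.map_component (f : Hom A B) (q : ℤ × ℤ) (a : A.carrier) :
    f (A.component q a) = B.component q (f a) := by
  have := component_comm (e := 0) (f := f.toAlgHom.toLinearMap)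
    (fun ha => by rw [add_zero]; exact f.map_mem ha) q a
  rw [add_zero] at this
  exact this.symm

lemma one_mem_gr : (1 : A.carrier) ∈ A.gr 0 := SetLike.GradedOne.one_mem

lemma algebraMap_mem_gr (c : ℂ) : algebraMap ℂ A.carrier c ∈ A.gr 0 := by
  rw [Algebra.algebraMap_eq_smul_one]
  exact Submodule.smul_mem _ _ one_mem_gr

lemma mul_mem_gr {p q : ℤ × ℤ} {a b : A.carrier} (ha : a ∈ A.gr p) (hb : b ∈ A.gr q) :
    a * b ∈ A.gr (p + q) := SetLike.GradedMul.mul_mem ha hb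

lemma del_one : A.del 1 = 0 := by
  have := A.del_mul 1 (one_mem_gr (A := A))
  simpa [totalDeg, ksign] using this

lemma delbar_one : A.delbar 1 = 0 := by
  have := A.delbar_mul 1 (one_mem_gr (A := A))
  simpa [totalDeg, ksign] using this

lemma del_algebraMap (c : ℂ) : A.del (algebraMap ℂ A.carrier c) = 0 := by
  rw [Algebra.algebraMap_eq_smul_one, map_smul, del_one, smul_zero]

lemma delbar_algebraMap (c : ℂ) : A.delbar (algebraMap ℂ A.carrier c) = 0 := by
  rw [Algebra.algebraMap_eq_smul_one, map_smul, delbar_one, smul_zero]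

lemma delbar_del (a : A.carrier) : A.delbar (A.del a) = - A.del (A.delbar a) :=
  eq_neg_of_add_eq_zero_right (A.del_delbar a)

/-- With the parity operator in place of the sign, both sides are linear in `a`, so no homogeneity
is needed. This form is applied to products in `A⁺A⁺`. -/
lemma del_mul_par (a b : A.carrier) : A.del (a * b) = A.del a * b + A.par a * A.del b := by
  have h : A.del ∘ₗ LinearMap.mulRight ℂ b =
      LinearMap.mulRight ℂ b ∘ₗ A.del + LinearMap.mulRight ℂ (A.del b) ∘ₗ A.par :=
    A.lin_ext fun p a ha => by simp [A.del_mul b ha, A.par_of_mem ha]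
  exact LinearMap.congr_fun h a

lemma delbar_mul_par (a b : A.carrier) :
    A.delbar (a * b) = A.delbar a * b + A.par a * A.delbar b := by
  have h : A.delbar ∘ₗ LinearMap.mulRight ℂ b =
      LinearMap.mulRight ℂ b ∘ₗ A.delbar + LinearMap.mulRight ℂ (A.delbar b) ∘ₗ A.par :=
    A.lin_ext fun p a ha => by simp [A.delbar_mul b ha, A.par_of_mem ha]
  exact LinearMap.congr_fun h a

end component

lemma Hom.ext {A : CBBA.{u}} {B : CBBA.{v}} {f g : Hom A B} (h : ∀ a, f a = g a) : f = g := by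
  cases f; cases g
  congr
  exact AlgHom.ext h

lemma Hom.isIso_of_bijective {A : CBBA.{u}} {B : CBBA.{v}} (f : Hom A B)
    (hf : Function.Bijective f) : f.IsIso := by
  let e := AlgEquiv.ofBijective f.toAlgHom hf
  have he : ∀ b, f (e.symm b) = b := fun b => e.apply_symm_apply b
  refine ⟨⟨e.symm.toAlgHom, fun {p b} hb => ?_, fun b => hf.1 ?_, fun b => hf.1 ?_⟩, ?_, ?_⟩
  -- The inverse preserves bidegrees because `f` commutes with the projections to components and is
  -- injective.
  · have h : A.component p (e.symm b) = e.symm b := hf.1 <| by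
      rw [f.map_component, he, B.component_of_mem hb]
    exact h ▸ A.component_mem p (e.symm b)
  · rw [f.map_del]
    exact (he _).trans (congrArg _ (he b).symm)
  · rw [f.map_delbar]
    exact (he _).trans (congrArg _ (he b).symm)
  · exact Hom.ext fun a => e.symm_apply_apply a
  · exact Hom.ext fun b => he b

/-! ### Products -/

/-- The product of two cbba's. -/
def prod (A : CBBA.{u}) (B : CBBA.{v}) : CBBA.{max u v} where
  carrier := A.carrier × B.carrier
  gr p := (A.gr p).prod (B.gr p)
  gradedMonoid :=
    { one_mem := ⟨one_mem_gr, one_mem_gr⟩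
      mul_mem := fun _ _ _ _ ha hb => ⟨mul_mem_gr ha.1 hb.1, mul_mem_gr ha.2 hb.2⟩ }
  isInternal := by
    refine isInternal_of_coaction _
      (Finsupp.mapRange.linearMap (LinearMap.inl ℂ _ _) ∘ₗ A.coact ∘ₗ LinearMap.fst ℂ _ _ +
        Finsupp.mapRange.linearMap (LinearMap.inr ℂ _ _) ∘ₗ B.coact ∘ₗ LinearMap.snd ℂ _ _) ?_ ?_
    · rintro p ⟨a, b⟩ ⟨ha, hb⟩
      simp only [LinearMap.add_apply, LinearMap.comp_apply, LinearMap.fst_apply,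
        LinearMap.snd_apply, A.coact_of_mem ha, B.coact_of_mem hb,
        Finsupp.mapRange.linearMap_apply, Finsupp.mapRange_single, ← Finsupp.single_add]
      simp
    · rintro ⟨a, b⟩
      have h1 : (⨆ p, A.gr p) ≤
          (⨆ p, (A.gr p).prod (B.gr p)).comap (LinearMap.inl ℂ A.carrier B.carrier) :=
        iSup_le fun p a ha => Submodule.mem_iSup_of_mem p ⟨ha, Submodule.zero_mem _⟩
      have h2 : (⨆ p, B.gr p) ≤
          (⨆ p, (A.gr p).prod (B.gr p)).comap (LinearMap.inr ℂ A.carrier B.carrier) :=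
        iSup_le fun p b hb => Submodule.mem_iSup_of_mem p ⟨Submodule.zero_mem _, hb⟩
      have h : ((a, b) : A.carrier × B.carrier) =
          LinearMap.inl ℂ A.carrier B.carrier a + LinearMap.inr ℂ A.carrier B.carrier b := by
        simp
      rw [h]
      exact Submodule.add_mem _ (h1 (A.iSup_gr a)) (h2 (B.iSup_gr b))
  mul_comm_of_mem ha hb := Prod.ext (A.mul_comm_of_mem ha.1 hb.1) (B.mul_comm_of_mem ha.2 hb.2)
  del := A.del.prodMap B.del
  delbar := A.delbar.prodMap B.delbar
  del_mem ha := ⟨A.del_mem ha.1, B.del_mem ha.2⟩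
  delbar_mem ha := ⟨A.delbar_mem ha.1, B.delbar_mem ha.2⟩
  del_del a := Prod.ext (A.del_del a.1) (B.del_del a.2)
  delbar_delbar a := Prod.ext (A.delbar_delbar a.1) (B.delbar_delbar a.2)
  del_delbar a := Prod.ext (A.del_delbar a.1) (B.del_delbar a.2)
  del_mul b ha := Prod.ext (A.del_mul b.1 ha.1) (B.del_mul b.2 ha.2)
  delbar_mul b ha := Prod.ext (A.delbar_mul b.1 ha.1) (B.delbar_mul b.2 ha.2)

/-- The first projection. -/
def fst (A : CBBA.{u}) (B : CBBA.{v}) : Hom (prod A B) A where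
  toAlgHom := AlgHom.fst ℂ A.carrier B.carrier
  map_mem h := h.1
  map_del _ := rfl
  map_delbar _ := rfl

/-- The second projection. -/
def snd (A : CBBA.{u}) (B : CBBA.{v}) : Hom (prod A B) B where
  toAlgHom := AlgHom.snd ℂ A.carrier B.carrier
  map_mem h := h.2
  map_del _ := rfl
  map_delbar _ := rfl

/-! ### Lifting through acyclic surjections -/

/-- A subspace that is a sub-bicomplex. -/
structure IsSubBicomplex (A : CBBA.{u}) (W : Submodule ℂ A.carrier) : Prop where
  del_mem : ∀ a ∈ W, A.del a ∈ W
  delbar_mem : ∀ a ∈ W, A.delbar a ∈ W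
  component_mem : ∀ q, ∀ a ∈ W, A.component q a ∈ W

/-- If every closed element of a subspace is `∂∂̄`-exact in it, then compatible pairs are jointly
exact. -/
lemma exists_primitive {A : CBBA.{u}} {K : Submodule ℂ A.carrier}
    (hd : ∀ a ∈ K, A.del a ∈ K) (hb : ∀ a ∈ K, A.delbar a ∈ K)
    (hK : ∀ a ∈ K, A.del a = 0 → A.delbar a = 0 → ∃ b ∈ K, A.del (A.delbar b) = a)
    {a b : A.carrier} (haK : a ∈ K) (hbK : b ∈ K) (ha : A.del a = 0) (hb0 : A.delbar b = 0)
    (hab : A.del b + A.delbar a = 0) : ∃ y ∈ K, A.del y = a ∧ A.delbar y = b := by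
  -- The mixed term `∂̄a` is closed, hence `∂∂̄w`. Adding `∂w` to `a` and `∂̄w` to `b` makes each of
  -- them closed under both differentials, hence `∂∂̄u` and `∂∂̄v`.
  have hab' : A.del b = - A.delbar a := eq_neg_of_add_eq_zero_left hab
  obtain ⟨w, hwK, hw⟩ := hK (A.delbar a) (hb a haK)
    (by rw [← neg_eq_zero, ← delbar_del, ha, map_zero]) (A.delbar_delbar a)
  obtain ⟨u, huK, hu⟩ := hK (a + A.del w) (K.add_mem haK (hd w hwK))
    (by rw [map_add, ha, A.del_del, add_zero]) (by rw [map_add, delbar_del, hw, add_neg_cancel])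
  obtain ⟨v, hvK, hv⟩ := hK (b + A.delbar w) (K.add_mem hbK (hb w hwK))
    (by rw [map_add, hab', hw, neg_add_cancel]) (by rw [map_add, hb0, A.delbar_delbar, add_zero])
  refine ⟨- w + A.delbar u - A.del v,
    K.sub_mem (K.add_mem (K.neg_mem hwK) (hb u huK)) (hd v hvK), ?_, ?_⟩
  · rw [map_sub, map_add, map_neg, hu, A.del_del]; abel
  · rw [map_sub, map_add, map_neg, delbar_del, hv, A.delbar_delbar]; abel

/-! ### Morphisms out of free graded-commutative algebras -/

section nilpotent
variable {M : CBBA.{u}} {C : CBBA.{v}} {I : Type u} {δ : I → ℤ × ℤ} {x : I → M.carrier}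
  {hx : ∀ i, x i ∈ M.gr (δ i)}

lemma lift_gen (A : CBBA.{v}) (y : I → A.carrier) (hy : ∀ i, y i ∈ A.gr (δ i)) (i : I) :
    FreeGC.lift A y hy (FreeGC.gen δ i) = y i :=
  FreeGC.liftAlg_gen _ _ _

lemma lift_mon_mem (A : CBBA.{v}) (y : I → A.carrier) (hy : ∀ i, y i ∈ A.gr (δ i)) (l : List I) :
    FreeGC.lift A y hy (FreeGC.mon δ l) ∈ A.gr (l.map δ).sum := by
  induction l with
  | nil => rw [FreeGC.mon_nil, map_one]; exact one_mem_gr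
  | cons i l ih =>
    rw [FreeGC.mon_cons, map_mul, lift_gen]
    exact mul_mem_gr (hy i) ih

/-- The algebra map out of a free cbba with prescribed values on the generators. -/
def freeLift (hbij : Function.Bijective (FreeGC.lift M x hx)) (y : I → C.carrier)
    (hy : ∀ i, y i ∈ C.gr (δ i)) : M.carrier →ₐ[ℂ] C.carrier :=
  (FreeGC.lift C y hy).comp (AlgEquiv.ofBijective (FreeGC.lift M x hx) hbij).symm.toAlgHom

variable (hbij : Function.Bijective (FreeGC.lift M x hx)) {y : I → C.carrier}
  (hy : ∀ i, y i ∈ C.gr (δ i))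

lemma freeLift_lift (a : FreeGC δ) :
    freeLift hbij y hy (FreeGC.lift M x hx a) = FreeGC.lift C y hy a :=
  congrArg (FreeGC.lift C y hy)
    ((AlgEquiv.ofBijective (FreeGC.lift M x hx) hbij).symm_apply_apply a)

lemma freeLift_apply (i : I) : freeLift hbij y hy (x i) = y i := by
  have := freeLift_lift hbij hy (FreeGC.gen δ i)
  rwa [lift_gen, lift_gen] at this

/-- Bijectivity of `FreeGC.lift M x hx` is an assumption on algebras only. The bigrading of `M` is
recovered from it by checking on monomials that the map commutes with the projections to components.
-/
lemma freeLift_mem {p : ℤ × ℤ} {a : M.carrier} (ha : a ∈ M.gr p) :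
    freeLift hbij y hy a ∈ C.gr p := by
  have h : C.component p ∘ₗ (freeLift hbij y hy).toLinearMap ∘ₗ
        (FreeGC.lift M x hx).toLinearMap =
      (freeLift hbij y hy).toLinearMap ∘ₗ M.component p ∘ₗ
        (FreeGC.lift M x hx).toLinearMap := by
    refine FreeGC.lin_ext δ fun l => ?_
    simp only [LinearMap.comp_apply, AlgHom.toLinearMap_apply]
    have h1 := lift_mon_mem M x hx l
    have h2 := lift_mon_mem C y hy l
    by_cases hp : (l.map δ).sum = p
    · rw [M.component_of_mem (hp ▸ h1), freeLift_lift, C.component_of_mem (hp ▸ h2)]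
    · rw [M.component_of_mem_of_ne h1 hp, freeLift_lift, C.component_of_mem_of_ne h2 hp, map_zero]
  obtain ⟨b, rfl⟩ := hbij.2 a
  have h := LinearMap.congr_fun h b
  simp only [LinearMap.comp_apply, AlgHom.toLinearMap_apply] at h
  rw [M.component_of_mem ha] at h
  exact h ▸ C.component_mem _ _

/-- Induction principle for the subalgebra generated by some of the generators. -/
lemma adjoin_gen_induction {s : Set I} (S : Submodule ℂ M.carrier)
    (h1 : 1 ∈ S) (hmul : ∀ i ∈ s, ∀ a ∈ S, x i * a ∈ S) {a : M.carrier}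
    (ha : a ∈ Algebra.adjoin ℂ (x '' s)) : a ∈ S := by
  rw [← Subalgebra.mem_toSubmodule, Algebra.adjoin_eq_span] at ha
  refine Submodule.span_le.2 (fun a ha => ?_) ha
  refine Submonoid.closure_induction_left (motive := fun a _ => a ∈ S) h1 ?_ ha
  rintro _ ⟨i, hi, rfl⟩ a _ hS
  exact hmul i hi a hS

/-- Both composites obey the same twisted Leibniz rule, so agreement on generators suffices.
Restricting to a set `s` of generators lets this be used in the middle of a recursion, when `g` is
correct only on the generators already treated. -/
lemma map_diff_of_mem_adjoin {D : M.carrier →ₗ[ℂ] M.carrier} {D' : C.carrier →ₗ[ℂ] C.carrier}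
    (hx : ∀ i, x i ∈ M.gr (δ i)) (h1 : D 1 = 0) (h1' : D' 1 = 0)
    (hD : ∀ {p a} (b), a ∈ M.gr p → D (a * b) = D a * b + ksign (totalDeg p) • (a * D b))
    (hD' : ∀ {p a} (b), a ∈ C.gr p → D' (a * b) = D' a * b + ksign (totalDeg p) • (a * D' b))
    (g : M.carrier →ₐ[ℂ] C.carrier) {s : Set I} (hg : ∀ i ∈ s, g (x i) ∈ C.gr (δ i))
    (hs : ∀ i ∈ s, g (D (x i)) = D' (g (x i))) {a : M.carrier}
    (ha : a ∈ Algebra.adjoin ℂ (x '' s)) : g (D a) = D' (g a) := by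
  refine adjoin_gen_induction (LinearMap.eqLocus (g.toLinearMap ∘ₗ D) (D' ∘ₗ g.toLinearMap))
    ?_ (fun i hi a ha => ?_) ha
  · simp [LinearMap.mem_eqLocus, h1, h1']
  · simp only [LinearMap.mem_eqLocus, LinearMap.comp_apply, AlgHom.toLinearMap_apply] at ha ⊢
    rw [hD a (hx i), map_mul, hD' _ (hg i hi), map_add, map_mul, map_smul, map_mul, hs i hi, ha]

lemma algHom_congr_of_mem_adjoin {g g' : M.carrier →ₐ[ℂ] C.carrier} {s : Set I}
    (h : ∀ i ∈ s, g (x i) = g' (x i)) {a : M.carrier}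
    (ha : a ∈ Algebra.adjoin ℂ (x '' s)) : g a = g' a := by
  have : Algebra.adjoin ℂ (x '' s) ≤ AlgHom.equalizer g g' := by
    refine Algebra.adjoin_le ?_
    rintro _ ⟨i, hi, rfl⟩
    exact h i hi
  exact this ha

end nilpotent

/-- A morphism out of a nilpotent cbba lifts through a surjection with acyclic kernel. Here the
surjection is the restriction of `p` to a differential bigraded subalgebra `W`. -/
theorem exists_lift {M : CBBA.{u}} (hM : M.IsNilpotent) {C : CBBA.{v}} {A : CBBA.{w}}
    (p : Hom C A) (W : Subalgebra ℂ C.carrier) (hW : C.IsSubBicomplex W.toSubmodule)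
    (hsurj : ∀ a, ∃ c ∈ W, p c = a)
    (hacyc : ∀ c ∈ W, p c = 0 → C.del c = 0 → C.delbar c = 0 →
      ∃ b ∈ W, p b = 0 ∧ C.del (C.delbar b) = c) (φ : Hom M A) :
    ∃ f : Hom M C, (∀ m, f m ∈ W) ∧ ∀ m, p (f m) = φ m := by
  obtain ⟨I, _, hwf, δ, x, hx, hbij, hdiff⟩ := hM
  -- Projecting `v i` to bidegree `δ i` makes `G v` defined for every `v`, in particular before the
  -- values at later generators have been chosen.
  let G : (I → C.carrier) → M.carrier →ₐ[ℂ] C.carrier := fun v =>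
    freeLift hbij (fun i => C.component (δ i) (v i)) fun i => C.component_mem _ _
  have hG : ∀ v i, v i ∈ C.gr (δ i) → G v (x i) = v i := fun v i hv => by
    rw [freeLift_apply, C.component_of_mem hv]
  let R : I → (I → C.carrier) → C.carrier → Prop := fun i v y =>
    y ∈ C.gr (δ i) ∧ y ∈ W ∧ p y = φ (x i) ∧ C.del y = G v (M.del (x i)) ∧
      C.delbar y = G v (M.delbar (x i))
  have hcongr : ∀ i v v' y, (∀ j, j < i → v j = v' j) → R i v y → R i v' y := by
    rintro i v v' y hv ⟨h1, h2, h3, h4, h5⟩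
    have : ∀ j ∈ Set.Iio i, G v (x j) = G v' (x j) := fun j hj => by
      rw [freeLift_apply, freeLift_apply, hv j hj]
    exact ⟨h1, h2, h3, h4.trans (algHom_congr_of_mem_adjoin this (hdiff i).1),
      h5.trans (algHom_congr_of_mem_adjoin this (hdiff i).2)⟩
  have hex : ∀ i v, (∀ j, j < i → R j v (v j)) → ∃ y, R i v y := by
    intro i v hv
    have hgr : ∀ j ∈ Set.Iio i, G v (x j) ∈ C.gr (δ j) := fun j hj => by
      rw [hG v j (hv j hj).1]; exact (hv j hj).1
    have hGd : ∀ {a}, a ∈ Algebra.adjoin ℂ (x '' Set.Iio i) → G v (M.del a) = C.del (G v a) :=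
      map_diff_of_mem_adjoin hx del_one del_one M.del_mul C.del_mul _ hgr fun j hj => by
        rw [hG v j (hv j hj).1, (hv j hj).2.2.2.1]
    have hGb : ∀ {a}, a ∈ Algebra.adjoin ℂ (x '' Set.Iio i) →
        G v (M.delbar a) = C.delbar (G v a) :=
      map_diff_of_mem_adjoin hx delbar_one delbar_one M.delbar_mul C.delbar_mul _ hgr
        fun j hj => by rw [hG v j (hv j hj).1, (hv j hj).2.2.2.2]
    have hGW : ∀ {a}, a ∈ Algebra.adjoin ℂ (x '' Set.Iio i) → G v a ∈ W := fun ha =>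
      adjoin_gen_induction ((W.comap (G v)).toSubmodule) (by simp)
        (fun j hj a ha => (W.comap (G v)).mul_mem
          (by rw [Subalgebra.mem_comap, hG v j (hv j hj).1]; exact (hv j hj).2.1) ha) ha
    have hGp : ∀ {a}, a ∈ Algebra.adjoin ℂ (x '' Set.Iio i) → p (G v a) = φ a := fun ha =>
      algHom_congr_of_mem_adjoin (g := p.toAlgHom.comp (G v)) (fun j hj => by
        rw [AlgHom.comp_apply, hG v j (hv j hj).1, (hv j hj).2.2.1]) ha
    -- `y₀` has the right image but possibly the wrong differentials. The two errors lie in `W ∩ ker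
    -- p` and satisfy the compatibilities of `exists_primitive`, so some `y₁` in the acyclic kernel
    -- corrects both at once.
    obtain ⟨y₀, hy₀W, hy₀⟩ := hsurj (φ (x i))
    have h1 := (hdiff i).1
    have h2 := (hdiff i).2
    obtain ⟨y₁, ⟨hy₁W, hy₁⟩, hy₁d, hy₁b⟩ := exists_primitive (A := C)
      (K := W.toSubmodule ⊓ LinearMap.ker p.toAlgHom.toLinearMap)
      (fun a ha => ⟨hW.del_mem a ha.1, by
        have : p a = 0 := ha.2
        simp [p.map_del, this]⟩)
      (fun a ha => ⟨hW.delbar_mem a ha.1, by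
        have : p a = 0 := ha.2
        simp [p.map_delbar, this]⟩)
      (fun a ha h h' => by
        obtain ⟨b, hb, hb', hb''⟩ := hacyc a ha.1 ha.2 h h'
        exact ⟨b, ⟨hb, hb'⟩, hb''⟩)
      (a := G v (M.del (x i)) - C.del y₀) (b := G v (M.delbar (x i)) - C.delbar y₀)
      ⟨W.sub_mem (hGW h1) (hW.del_mem _ hy₀W), by
        simp [hGp h1, p.map_del, φ.map_del, hy₀]⟩
      ⟨W.sub_mem (hGW h2) (hW.delbar_mem _ hy₀W), by
        simp [hGp h2, p.map_delbar, φ.map_delbar, hy₀]⟩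
      (by rw [map_sub, ← hGd h1, M.del_del, C.del_del, map_zero, sub_zero])
      (by rw [map_sub, ← hGb h2, M.delbar_delbar, C.delbar_delbar, map_zero, sub_zero])
      (by rw [map_sub, map_sub, ← hGd h2, ← hGb h1, delbar_del, delbar_del, map_neg]; abel)
    have hyd : C.del (y₀ + y₁) = G v (M.del (x i)) := by rw [map_add, hy₁d]; abel
    have hyb : C.delbar (y₀ + y₁) = G v (M.delbar (x i)) := by rw [map_add, hy₁b]; abel
    -- Neither summand needs to be homogeneous. Projecting to bidegree `δ i` keeps all the
    -- equations, since their other sides are homogeneous.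
    refine ⟨C.component (δ i) (y₀ + y₁), C.component_mem _ _,
      hW.component_mem _ _ (W.add_mem hy₀W hy₁W), ?_, ?_, ?_⟩
    · have : p y₁ = 0 := hy₁
      rw [p.map_component, map_add, hy₀, this, add_zero, A.component_of_mem (φ.map_mem (hx i))]
    · rw [← component_del, hyd, C.component_of_mem]
      exact freeLift_mem hbij _ (M.del_mem (hx i))
    · rw [← component_delbar, hyb, C.component_of_mem]
      exact freeLift_mem hbij _ (M.delbar_mem (hx i))
  obtain ⟨v, hv⟩ := exists_forall_of_wellFounded (· < ·) hwf.wf R hcongr hex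
  have htop : ∀ m : M.carrier, m ∈ Algebra.adjoin ℂ (x '' Set.univ) := by
    intro m
    obtain ⟨a, rfl⟩ := hbij.2 m
    have h : (⊤ : Submodule ℂ (FreeGC δ)) ≤
        (Algebra.adjoin ℂ (x '' Set.univ)).toSubmodule.comap
          (FreeGC.lift M x hx).toLinearMap := by
      rw [← eq_top_iff.2 fun a _ => FreeGC.span_mon δ a, Submodule.span_le]
      rintro _ ⟨l, rfl⟩
      change FreeGC.lift M x hx (FreeGC.mon δ l) ∈ Algebra.adjoin ℂ (x '' Set.univ)
      induction l with
      | nil => rw [FreeGC.mon_nil, map_one]; exact Subalgebra.one_mem _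
      | cons i l ih =>
        rw [FreeGC.mon_cons, map_mul, lift_gen]
        exact Subalgebra.mul_mem _ (Algebra.subset_adjoin ⟨i, trivial, rfl⟩) ih
    exact h (Submodule.mem_top (x := a))
  have hgr : ∀ j ∈ Set.univ, G v (x j) ∈ C.gr (δ j) := fun j _ => by
    rw [hG v j (hv j).1]; exact (hv j).1
  refine ⟨⟨G v, fun ha => freeLift_mem hbij _ ha, fun m => ?_, fun m => ?_⟩, fun m => ?_,
    fun m => ?_⟩
  · exact map_diff_of_mem_adjoin hx del_one del_one M.del_mul C.del_mul _ hgr (fun j _ => by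
      rw [hG v j (hv j).1, (hv j).2.2.2.1]) (htop m)
  · exact map_diff_of_mem_adjoin hx delbar_one delbar_one M.delbar_mul C.delbar_mul _ hgr
      (fun j _ => by rw [hG v j (hv j).1, (hv j).2.2.2.2]) (htop m)
  · exact adjoin_gen_induction ((W.comap (G v)).toSubmodule) (by simp)
      (fun j _ a ha => (W.comap (G v)).mul_mem
        (by rw [Subalgebra.mem_comap, hG v j (hv j).1]; exact (hv j).2.1) ha) (htop m)
  · exact algHom_congr_of_mem_adjoin (g := p.toAlgHom.comp (G v)) (fun j _ => by
      rw [AlgHom.comp_apply, hG v j (hv j).1, (hv j).2.2.1]) (htop m)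

end CBBA

/-! ### Odd derivations and word length on free graded-commutative algebras -/

lemma ksign_mul_of_odd (m : ℤ) {n : ℤ} (hn : Odd n) : ksign (m * n) = ksign m := by
  rcases Int.even_or_odd m with h | h
  · rw [ksign_even h, ksign_even (h.mul_right n)]
  · rw [ksign_odd h, ksign_odd (h.mul hn)]

namespace FreeGC

variable {I : Type u} {δ : I → ℤ × ℤ}

/-- An odd derivation of bidegree `e` on a free graded-commutative algebra. -/
structure IsOddDerivation (D : FreeGC δ →ₗ[ℂ] FreeGC δ) (e : ℤ × ℤ) : Prop where
  odd : Odd (totalDeg e)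
  gen_mem : ∀ i, D (gen δ i) ∈ gr δ (δ i + e)
  map_mul : ∀ {p a} (b), a ∈ gr δ p → D (a * b) = D a * b + ksign (totalDeg p) • (a * D b)

lemma der_isOddDerivation {x : I → FreeGC δ} {e : ℤ × ℤ} (he : totalDeg e = 1)
    (hx : ∀ i, x i ∈ gr δ (δ i + e)) : IsOddDerivation (der x he hx) e where
  odd := he ▸ odd_one
  gen_mem i := der_mem he hx (FreeGC.gen_mem δ i)
  map_mul := der_mul he hx

/-- The matrices encode a derivation as an algebra map: multiplicativity of the upper right entry is
the Leibniz rule. Any odd total degree is allowed since the contractions of `Ω` have total degree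
`-1`. -/
lemma oddMatrix_comm {x : I → FreeGC δ} {e : ℤ × ℤ} (he : Odd (totalDeg e))
    (hx : ∀ i, x i ∈ gr δ (δ i + e)) (i j : I) :
    !![ksign (totalDeg (δ i)) • gen δ i, x i; 0, gen δ i] *
        !![ksign (totalDeg (δ j)) • gen δ j, x j; 0, gen δ j] =
      ksign (totalDeg (δ i) * totalDeg (δ j)) •
        (!![ksign (totalDeg (δ j)) • gen δ j, x j; 0, gen δ j] *
          !![ksign (totalDeg (δ i)) • gen δ i, x i; 0, gen δ i]) := by
  have h1 := gr_comm δ (gen_mem δ i) (hx j)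
  have h2 := gr_comm δ (hx i) (gen_mem δ j)
  rw [totalDeg_add, mul_add, ksign_add, ksign_mul_of_odd _ he] at h1
  rw [totalDeg_add, add_mul, ksign_add, mul_comm (totalDeg e), ksign_mul_of_odd _ he] at h2
  ext a b
  fin_cases a <;> fin_cases b
  · simp [Matrix.mul_apply, Fin.sum_univ_two, gen_mul_gen δ i j, smul_smul]
    ring_nf
  · rcases Int.even_or_odd (totalDeg (δ i)) with k1 | k1 <;>
    rcases Int.even_or_odd (totalDeg (δ j)) with k2 | k2 <;>
    simp [Matrix.mul_apply, Fin.sum_univ_two, h1, h2, ksign_even, ksign_odd, k1, k2] <;>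
    abel
  · simp [Matrix.mul_apply, Fin.sum_univ_two]
  · simp [Matrix.mul_apply, Fin.sum_univ_two, gen_mul_gen δ i j]

/-- Odd derivations exist with arbitrary values of the right bidegree on the generators. -/
lemma exists_isOddDerivation (x : I → FreeGC δ) {e : ℤ × ℤ} (he : Odd (totalDeg e))
    (hx : ∀ i, x i ∈ gr δ (δ i + e)) :
    ∃ D, IsOddDerivation D e ∧ ∀ i, D (gen δ i) = x i := by
  let F : FreeGC δ →ₐ[ℂ] Matrix (Fin 2) (Fin 2) (FreeGC δ) :=
    liftAlg (fun i => !![ksign (totalDeg (δ i)) • gen δ i, x i; 0, gen δ i]) (oddMatrix_comm he hx)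
  have hF : ∀ i, F (gen δ i) = !![ksign (totalDeg (δ i)) • gen δ i, x i; 0, gen δ i] :=
    fun i => liftAlg_gen _ _ i
  have h11 : ∀ a, F a 1 1 = a := by
    have h : Matrix.entryLinearMap ℂ (FreeGC δ) 1 1 ∘ₗ F.toLinearMap = LinearMap.id := by
      refine lin_ext δ fun l => ?_
      simp only [LinearMap.comp_apply, AlgHom.toLinearMap_apply, Matrix.entryLinearMap_apply,
        LinearMap.id_apply]
      induction l with
      | nil => simp [mon_nil]
      | cons i l ih =>
        rw [mon_cons, map_mul, hF, Matrix.mul_apply, Fin.sum_univ_two, ih]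
        simp
    exact fun a => LinearMap.congr_fun h a
  let D : FreeGC δ →ₗ[ℂ] FreeGC δ := Matrix.entryLinearMap ℂ (FreeGC δ) 0 1 ∘ₗ F.toLinearMap
  have hD : ∀ a, D a = F a 0 1 := fun _ => rfl
  have hgen : ∀ i, D (gen δ i) = x i := fun i => by rw [hD, hF]; rfl
  have hmul : ∀ i a, D (gen δ i * a) =
      D (gen δ i) * a + ksign (totalDeg (δ i)) • (gen δ i * D a) := by
    intro i a
    rw [hgen, hD, map_mul, hF, Matrix.mul_apply, Fin.sum_univ_two, h11, hD]
    simp [add_comm]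
  refine ⟨D, ⟨he, fun i => hgen i ▸ hx i, fun {p a} b ha => ?_⟩, hgen⟩
  refine gr_le δ (LinearMap.eqLocus (D ∘ₗ LinearMap.mulRight ℂ b)
    (LinearMap.mulRight ℂ b ∘ₗ D + ksign (totalDeg p) • LinearMap.mulRight ℂ (D b)))
    (fun l hl => ?_) ha
  simp only [LinearMap.mem_eqLocus, LinearMap.comp_apply, LinearMap.mulRight_apply,
    LinearMap.add_apply, LinearMap.smul_apply]
  subst hl
  clear ha
  induction l with
  | nil => simp [mon_nil, hD, totalDeg, ksign]
  | cons i l ih =>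
    rw [mon_cons, mul_assoc, hmul, ih, hmul, List.map_cons, List.sum_cons, totalDeg_add,
      ksign_add]
    simp only [add_mul, mul_add, smul_mul_assoc, mul_smul_comm, mul_assoc, smul_add, smul_smul]
    abel

namespace IsOddDerivation

variable {D D' : FreeGC δ →ₗ[ℂ] FreeGC δ} {e e' : ℤ × ℤ}

lemma map_one (hD : IsOddDerivation D e) : D 1 = 0 := by
  have := hD.map_mul 1 (mon_mem δ [])
  simpa [mon_nil, totalDeg, ksign] using this

lemma map_mem (hD : IsOddDerivation D e) {p : ℤ × ℤ} {a : FreeGC δ} (ha : a ∈ gr δ p) :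
    D a ∈ gr δ (p + e) := by
  refine gr_le δ ((gr δ (p + e)).comap D) (fun l hl => ?_) ha
  rw [Submodule.mem_comap]
  subst hl
  clear ha
  induction l with
  | nil => rw [mon_nil, hD.map_one]; exact Submodule.zero_mem _
  | cons i l ih =>
    rw [mon_cons, hD.map_mul _ (FreeGC.gen_mem δ i), List.map_cons, List.sum_cons]
    refine Submodule.add_mem _ ?_ (Submodule.smul_mem _ _ ?_)
    · have := SetLike.GradedMul.mul_mem (hD.gen_mem i) (mon_mem δ l)
      rwa [add_right_comm] at this
    · rw [add_assoc]
      exact SetLike.GradedMul.mul_mem (FreeGC.gen_mem δ i) ih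

/-- The anticommutator of two odd derivations is determined by its values on the generators. -/
lemma anticomm_mon (hD : IsOddDerivation D e) (hD' : IsOddDerivation D' e') (c : ℂ)
    (h : ∀ i, D (D' (gen δ i)) + D' (D (gen δ i)) = c • gen δ i) (l : List I) :
    D (D' (mon δ l)) + D' (D (mon δ l)) = (c * l.length) • mon δ l := by
  induction l with
  | nil => simp [mon_nil, hD.map_one, hD'.map_one]
  | cons i l ih =>
    have h1 := eq_sub_of_add_eq (h i)
    have h2 := eq_sub_of_add_eq ih
    rw [mon_cons, hD.map_mul _ (FreeGC.gen_mem δ i), hD'.map_mul _ (FreeGC.gen_mem δ i), map_add,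
      map_add, map_smul, map_smul, hD.map_mul _ (hD'.gen_mem i), hD'.map_mul _ (hD.gen_mem i),
      hD.map_mul _ (FreeGC.gen_mem δ i), hD'.map_mul _ (FreeGC.gen_mem δ i), totalDeg_add,
      totalDeg_add, ksign_add, ksign_add, ksign_odd hD.odd, ksign_odd hD'.odd, h1, h2]
    simp only [sub_mul, mul_sub, smul_mul_assoc, mul_smul_comm, smul_add, smul_sub, smul_smul,
      ksign_mul_self]
    push_cast [List.length_cons]
    rcases Int.even_or_odd (totalDeg (δ i)) with k | k <;>
    simp only [ksign_even, ksign_odd, k] <;> module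

end IsOddDerivation

variable (δ) in
/-- The span of the monomials of length `n`. -/
def words (n : ℕ) : Submodule ℂ (FreeGC δ) :=
  Submodule.span ℂ {x | ∃ l : List I, l.length = n ∧ x = mon δ l}

lemma mon_mem_words (l : List I) : mon δ l ∈ words δ l.length :=
  Submodule.subset_span ⟨l, rfl, rfl⟩

lemma words_le {n : ℕ} (S : Submodule ℂ (FreeGC δ))
    (h : ∀ l : List I, l.length = n → mon δ l ∈ S) : words δ n ≤ S := by
  refine Submodule.span_le.2 ?_
  rintro _ ⟨l, hl, rfl⟩
  exact h l hl

lemma gen_mem_words (i : I) : gen δ i ∈ words δ 1 := by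
  simpa [mon] using mon_mem_words (δ := δ) [i]

lemma mul_mem_words {m n : ℕ} {a b : FreeGC δ} (ha : a ∈ words δ m) (hb : b ∈ words δ n) :
    a * b ∈ words δ (m + n) := by
  refine words_le ((words δ (m + n)).comap (LinearMap.mulRight ℂ b)) (fun l hl => ?_) ha
  refine words_le ((words δ (m + n)).comap (LinearMap.mulLeft ℂ (mon δ l))) (fun l' hl' => ?_) hb
  simp only [Submodule.mem_comap, LinearMap.mulLeft_apply]
  rw [← mon_append, ← hl, ← hl', ← List.length_append]
  exact mon_mem_words _

lemma IsOddDerivation.map_words {D : FreeGC δ →ₗ[ℂ] FreeGC δ} {e : ℤ × ℤ}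
    (hD : IsOddDerivation D e) (hgen : ∀ i, D (gen δ i) ∈ words δ 1) {n : ℕ} {a : FreeGC δ}
    (ha : a ∈ words δ n) : D a ∈ words δ n := by
  refine words_le ((words δ n).comap D) (fun l hl => ?_) ha
  rw [Submodule.mem_comap]
  subst hl
  clear ha
  induction l with
  | nil => rw [mon_nil, hD.map_one]; exact Submodule.zero_mem _
  | cons i l ih =>
    rw [mon_cons, hD.map_mul _ (FreeGC.gen_mem δ i), List.length_cons, add_comm]
    exact Submodule.add_mem _ (mul_mem_words (hgen i) (mon_mem_words l))
      (Submodule.smul_mem _ _ (mul_mem_words (gen_mem_words i) ih))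

/-- There is an operator that scales the monomials by a function of their length. -/
lemma exists_scaling (f : ℕ → ℂ) :
    ∃ P : FreeGC δ →ₗ[ℂ] FreeGC δ, ∀ l, P (mon δ l) = f l.length • mon δ l := by
  -- Monomials satisfy linear relations, so prescribing values on them is not legitimate by itself.
  -- The algebra map `x_i ↦ x_i T` records the length in the exponent of `T`; it exists because the
  -- defining relations are homogeneous in word length.
  let F : FreeGC δ →ₐ[ℂ] Polynomial (FreeGC δ) :=
    liftAlg (fun i => Polynomial.monomial 1 (gen δ i)) fun i j => by
      rw [Polynomial.monomial_mul_monomial, Polynomial.monomial_mul_monomial, gen_mul_gen,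
        Polynomial.smul_monomial]
  have hF : ∀ l, F (mon δ l) = Polynomial.monomial l.length (mon δ l) := by
    intro l
    induction l with
    | nil => simp [mon_nil]
    | cons i l ih =>
      rw [mon_cons, map_mul, ih, liftAlg_gen, Polynomial.monomial_mul_monomial, List.length_cons,
        add_comm]
  refine ⟨Polynomial.lsum (fun n => f n • LinearMap.id) ∘ₗ F.toLinearMap, fun l => ?_⟩
  rw [LinearMap.comp_apply, AlgHom.toLinearMap_apply, hF]
  simp [Polynomial.lsum_apply, Polynomial.sum_monomial_index]

/-- A monomial of nonzero bidegree contains a generator of nonzero bidegree, which `ε` kills. -/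
lemma algHom_eq_zero_of_mem {ε : FreeGC δ →ₐ[ℂ] ℂ} (hε : ∀ i, δ i ≠ 0 → ε (gen δ i) = 0)
    {p : ℤ × ℤ} (hp : p ≠ 0) {a : FreeGC δ} (ha : a ∈ gr δ p) : ε a = 0 := by
  refine gr_le δ (LinearMap.ker ε.toLinearMap) (fun l hl => ?_) ha
  rw [LinearMap.mem_ker, AlgHom.toLinearMap_apply]
  have h : ∃ i ∈ l, δ i ≠ 0 := by
    by_contra! h
    refine hp (hl ▸ List.sum_eq_zero fun x hx => ?_)
    obtain ⟨i, hi, rfl⟩ := List.mem_map.1 hx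
    exact h i hi
  obtain ⟨i, hi, hi0⟩ := h
  rw [mon, map_list_prod]
  exact List.prod_eq_zero (List.mem_map.2 ⟨gen δ i, List.mem_map.2 ⟨i, hi, rfl⟩, hε i hi0⟩)

lemma IsOddDerivation.algHom_comp {D : FreeGC δ →ₗ[ℂ] FreeGC δ} {e : ℤ × ℤ}
    (hD : IsOddDerivation D e) {ε : FreeGC δ →ₐ[ℂ] ℂ} (hε : ∀ i, ε (D (gen δ i)) = 0)
    (a : FreeGC δ) : ε (D a) = 0 := by
  have h : ε.toLinearMap ∘ₗ D = 0 := by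
    refine lin_ext δ fun l => ?_
    simp only [LinearMap.comp_apply, AlgHom.toLinearMap_apply, LinearMap.zero_apply]
    induction l with
    | nil => rw [mon_nil, hD.map_one, map_zero]
    | cons i l ih =>
      rw [mon_cons, hD.map_mul _ (FreeGC.gen_mem δ i), map_add, _root_.map_mul, hε, map_smul,
        _root_.map_mul, ih]
      simp
  exact LinearMap.congr_fun h a

end FreeGC

/-! ### The contraction of `Ω` onto its constants -/

namespace Omega

open FreeGC PathGen

/-- Let `N` be the word length. There are odd derivations `j`, `k` inverting `∂` and `∂̄` on
generators, with `∂j + j∂ = N`, `∂̄k + k∂̄ = N` and `∂̄j + j∂̄ = 0`. For `h = N⁻² k j` this gives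
`∂̄h - h∂̄ = N⁻¹ j`, whose anticommutator with `∂` is the identity on words of positive length. All
operators preserve word length, so division by `N²` causes no trouble. -/
lemma exists_contraction_of_isOddDerivation {d b : FreeGC bideg →ₗ[ℂ] FreeGC bideg}
    (hd : IsOddDerivation d (1, 0)) (hb : IsOddDerivation b (0, 1))
    (hdg : ∀ i, d (gen bideg i) = delGen i) (hbg : ∀ i, b (gen bideg i) = delbarGen i)
    (ε : FreeGC bideg →ₐ[ℂ] ℂ) (hε : ∀ i, ε (gen bideg i) = 0) :
    ∃ h : FreeGC bideg →ₗ[ℂ] FreeGC bideg,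
      (∀ {p a}, a ∈ gr bideg p → h a ∈ gr bideg (p + (-1, -1))) ∧ h 1 = 0 ∧
        ∀ a, d (b (h a) - h (b a)) + (b (h (d a)) - h (b (d a))) =
          a - algebraMap ℂ (FreeGC bideg) (ε a) := by
  let g := gen bideg
  obtain ⟨j, hj, hjg⟩ := exists_isOddDerivation (δ := bideg) (e := (-1, 0))
    (fun | dt => g t | ddbt => g dbt | _ => 0) (by decide) (by
      rintro (_ | _ | _ | _)
      · exact Submodule.zero_mem _
      · exact FreeGC.gen_mem bideg t
      · exact Submodule.zero_mem _
      · exact FreeGC.gen_mem bideg dbt)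
  -- The sign in `k(∂∂̄t) = -∂t` comes from `∂̄∂t = -∂∂̄t`.
  obtain ⟨k, hk, hkg⟩ := exists_isOddDerivation (δ := bideg) (e := (0, -1))
    (fun | dbt => g t | ddbt => - g dt | _ => 0) (by decide) (by
      rintro (_ | _ | _ | _)
      · exact Submodule.zero_mem _
      · exact Submodule.zero_mem _
      · exact FreeGC.gen_mem bideg t
      · exact Submodule.neg_mem _ (FreeGC.gen_mem bideg dt))
  obtain ⟨P, hP⟩ := exists_scaling (δ := bideg) fun n => ((n : ℂ) ^ 2)⁻¹
  have hPw : ∀ {n a}, a ∈ words bideg n → P a = ((n : ℂ) ^ 2)⁻¹ • a := by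
    intro n a ha
    refine words_le (LinearMap.eqLocus P (((n : ℂ) ^ 2)⁻¹ • LinearMap.id)) (fun l hl => ?_) ha
    simp [LinearMap.mem_eqLocus, hP, hl]
  have hPgr : ∀ {p a}, a ∈ gr bideg p → P a ∈ gr bideg p := by
    intro p a ha
    refine gr_le bideg ((gr bideg p).comap P) (fun l hl => ?_) ha
    rw [Submodule.mem_comap, hP]
    exact Submodule.smul_mem _ _ (hl ▸ mon_mem bideg l)
  have hdw : ∀ {n a}, a ∈ words bideg n → d a ∈ words bideg n := fun ha => by
    refine hd.map_words (fun i => ?_) ha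
    rw [hdg]
    cases i <;> first | exact gen_mem_words _ | exact Submodule.zero_mem _
  have hbw : ∀ {n a}, a ∈ words bideg n → b a ∈ words bideg n := fun ha => by
    refine hb.map_words (fun i => ?_) ha
    rw [hbg]
    cases i <;> first
      | exact gen_mem_words _ | exact Submodule.zero_mem _
      | exact Submodule.neg_mem _ (gen_mem_words _)
  have hjw : ∀ {n a}, a ∈ words bideg n → j a ∈ words bideg n := fun ha => by
    refine hj.map_words (fun i => ?_) ha
    rw [hjg]
    cases i <;> first | exact gen_mem_words _ | exact Submodule.zero_mem _
  have hkw : ∀ {n a}, a ∈ words bideg n → k a ∈ words bideg n := fun ha => by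
    refine hk.map_words (fun i => ?_) ha
    rw [hkg]
    cases i <;> first
      | exact gen_mem_words _ | exact Submodule.zero_mem _
      | exact Submodule.neg_mem _ (gen_mem_words _)
  have hdj : ∀ {n a}, a ∈ words bideg n → d (j a) + j (d a) = (n : ℂ) • a := by
    intro n a ha
    refine words_le (LinearMap.eqLocus (d ∘ₗ j + j ∘ₗ d)
      ((n : ℂ) • LinearMap.id)) (fun l hl => ?_) ha
    subst hl
    refine (hd.anticomm_mon hj 1 (fun i => ?_) l).trans (by rw [one_mul]; rfl)
    rw [hjg, hdg, one_smul]
    cases i <;> simp only [delGen, map_zero, hjg, hdg, zero_add, add_zero, g]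
  have hbk : ∀ {n a}, a ∈ words bideg n →
      b (k a) + k (b a) = (n : ℂ) • a := by
    intro n a ha
    refine words_le (LinearMap.eqLocus (b ∘ₗ k + k ∘ₗ b)
      ((n : ℂ) • LinearMap.id)) (fun l hl => ?_) ha
    subst hl
    refine (hb.anticomm_mon hk 1 (fun i => ?_) l).trans (by rw [one_mul]; rfl)
    rw [hkg, hbg, one_smul]
    cases i <;> simp only [delbarGen, map_zero, map_neg, hkg, hbg, zero_add, add_zero, neg_neg, g]
  have hbj : ∀ a, b (j a) + j (b a) = 0 := by
    intro a
    have h : b ∘ₗ j + j ∘ₗ b = 0 := by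
      refine lin_ext bideg fun l => ?_
      refine (hb.anticomm_mon hj 0 (fun i => ?_) l).trans (by rw [zero_mul, zero_smul]; rfl)
      rw [hjg, hbg, zero_smul]
      cases i <;>
        simp only [delbarGen, map_zero, map_neg, hjg, hbg, add_zero, add_neg_cancel, g]
    exact LinearMap.congr_fun h a
  refine ⟨P ∘ₗ k ∘ₗ j, fun {p a} ha => ?_, ?_, ?_⟩
  · have := hPgr (hk.map_mem (hj.map_mem ha))
    rwa [add_assoc] at this
  · rw [LinearMap.comp_apply, LinearMap.comp_apply, hj.map_one, map_zero, map_zero]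
  have hw : ∀ {n a}, a ∈ words bideg n →
      b ((P ∘ₗ k ∘ₗ j) a) - (P ∘ₗ k ∘ₗ j) (b a) =
        (((n : ℂ) ^ 2)⁻¹ * n) • j a := by
    intro n a ha
    have h1 := eq_sub_of_add_eq (hbk (hjw ha))
    rw [LinearMap.comp_apply, LinearMap.comp_apply, LinearMap.comp_apply, LinearMap.comp_apply,
      hPw (hkw (hjw ha)), hPw (hkw (hjw (hbw ha))), map_smul, h1,
      eq_neg_of_add_eq_zero_left (hbj a), map_neg]
    module
  have key : (d ∘ₗ (b ∘ₗ (P ∘ₗ k ∘ₗ j) - (P ∘ₗ k ∘ₗ j) ∘ₗ b) +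
      (b ∘ₗ (P ∘ₗ k ∘ₗ j) - (P ∘ₗ k ∘ₗ j) ∘ₗ b) ∘ₗ d) =
        LinearMap.id - Algebra.linearMap ℂ (FreeGC bideg) ∘ₗ ε.toLinearMap := by
    refine lin_ext bideg fun l => ?_
    have hl := mon_mem_words (δ := bideg) l
    refine (congrArg₂ (· + ·) (congrArg d (hw hl)) (hw (hdw hl))).trans ?_
    rw [map_smul, ← smul_add, hdj hl, smul_smul]
    change _ = mon bideg l - algebraMap ℂ (FreeGC bideg) (ε (mon bideg l))
    -- On the empty word the length factor is zero whatever the value of `(0 ^ 2)⁻¹`, and the right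
    -- side is `1 - 1`.
    cases l with
    | nil => rw [mon_nil, map_one, map_one]; simp
    | cons i l =>
      rw [mon_cons, map_mul, hε, zero_mul, map_zero, sub_zero]
      have hne : ((i :: l).length : ℂ) ≠ 0 := by
        rw [List.length_cons]; exact Nat.cast_ne_zero.2 (Nat.succ_ne_zero _)
      rw [show (((i :: l).length : ℂ) ^ 2)⁻¹ * ((i :: l).length : ℂ) * ((i :: l).length : ℂ) = 1 by
        field_simp, one_smul]
  exact fun a => LinearMap.congr_fun key a

lemma eval_gen (s : ℂ) (i : PathGen) :
    Omega.eval s (gen bideg i) = match i with | .t => s | _ => 0 :=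
  liftAlg_gen _ _ i

/-- The contraction of `Ω` onto its constants: a homotopy of bidegree `(-1, -1)`. -/
lemma exists_contraction : ∃ h : Omega.carrier →ₗ[ℂ] Omega.carrier,
    (∀ {p a}, a ∈ Omega.gr p → h a ∈ Omega.gr (p + (-1, -1))) ∧ h 1 = 0 ∧
      ∀ a, Omega.del (Omega.delbar (h a) - h (Omega.delbar a)) +
        (Omega.delbar (h (Omega.del a)) - h (Omega.delbar (Omega.del a))) =
          a - algebraMap ℂ Omega.carrier (Omega.eval 0 a) :=
  exists_contraction_of_isOddDerivation (der_isOddDerivation (e := (1, 0)) rfl delGen_mem)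
    (der_isOddDerivation (e := (0, 1)) rfl delbarGen_mem) (der_gen (e := (1, 0)) rfl delGen_mem)
    (der_gen (e := (0, 1)) rfl delbarGen_mem) (Omega.eval 0) fun i =>
      (eval_gen 0 i).trans (by cases i <;> rfl)

/-- The evaluation at `s` as a morphism of cbba's. -/
def evalHom (s : ℂ) : CBBA.Hom Omega CBBA.base where
  toAlgHom := Omega.eval s
  map_mem {p a} ha := by
    change _ ∈ (if p = 0 then ⊤ else ⊥ : Submodule ℂ ℂ)
    split_ifs with hp
    · trivial
    · refine algHom_eq_zero_of_mem (δ := bideg) (ε := Omega.eval s) (fun i hi => ?_) hp ha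
      exact (eval_gen s i).trans (by cases i <;> first | rfl | exact absurd rfl hi)
  map_del a := (der_isOddDerivation (e := (1, 0)) rfl delGen_mem).algHom_comp (fun i =>
    (congrArg (Omega.eval s) (der_gen (e := (1, 0)) rfl delGen_mem i)).trans (by
      cases i
      · exact eval_gen s _
      · exact map_zero _
      · exact eval_gen s _
      · exact map_zero _)) a
  map_delbar a := (der_isOddDerivation (e := (0, 1)) rfl delbarGen_mem).algHom_comp (fun i =>
    (congrArg (Omega.eval s) (der_gen (e := (0, 1)) rfl delbarGen_mem i)).trans (by
      cases i
      · exact eval_gen s _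
      · exact (map_neg _ _).trans (neg_eq_zero.2 (eval_gen s _))
      · exact map_zero _
      · exact map_zero _)) a

/-- The generator `t` of `Ω`. -/
def var : Omega.carrier := gen bideg t

lemma eval_var (s : ℂ) : Omega.eval s var = s := eval_gen s t

/-- A chosen contraction of `Ω` onto its constants. -/
def contraction : Omega.carrier →ₗ[ℂ] Omega.carrier := exists_contraction.choose

lemma contraction_mem {p : ℤ × ℤ} {a : Omega.carrier} (ha : a ∈ Omega.gr p) :
    contraction a ∈ Omega.gr (p + (-1, -1)) := exists_contraction.choose_spec.1 ha

lemma contraction_one : contraction 1 = 0 := exists_contraction.choose_spec.2.1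

lemma contraction_spec (a : Omega.carrier) :
    Omega.del (Omega.delbar (contraction a) - contraction (Omega.delbar a)) +
      (Omega.delbar (contraction (Omega.del a)) - contraction (Omega.delbar (Omega.del a))) =
        a - algebraMap ℂ Omega.carrier (Omega.eval 0 a) := exists_contraction.choose_spec.2.2 a

end Omega

/-! ### Morphisms out of tensor products -/

namespace CBBA

/-- The unit morphism `ℂ → A`. -/
def unit (A : CBBA.{u}) : Hom base A where
  toAlgHom := Algebra.ofId ℂ A.carrier
  map_mem {p a} ha := by
    change a ∈ (if p = 0 then ⊤ else ⊥ : Submodule ℂ ℂ) at ha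
    split_ifs at ha with hp
    · exact hp ▸ algebraMap_mem_gr a
    · rw [show a = (0 : ℂ) from ha]
      exact (map_zero (algebraMap ℂ A.carrier)).symm ▸ Submodule.zero_mem _
  map_del a := (map_zero (algebraMap ℂ A.carrier)).trans (del_algebraMap a).symm
  map_delbar a := (map_zero (algebraMap ℂ A.carrier)).trans (delbar_algebraMap a).symm

section tensor
variable {A : CBBA.{u}} {B : CBBA.{v}} {C : CBBA.{w}}

/-- The pure tensor `a ⊗ b`, as an element of the tensor product of cbba's. -/
def tmul (a : A.carrier) (b : B.carrier) : (tensor A B).carrier := tm a b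

lemma tmul_add_left (a a' : A.carrier) (b : B.carrier) :
    tmul (a + a') b = tmul a b + tmul a' b := tm_add_left a a' b

lemma tmul_add_right (a : A.carrier) (b b' : B.carrier) :
    tmul a (b + b') = tmul a b + tmul a b' := tm_add_right a b b'

lemma tmul_smul_left (c : ℂ) (a : A.carrier) (b : B.carrier) :
    tmul (c • a) b = c • tmul a b := tm_smul_left c a b

lemma tmul_smul_right (c : ℂ) (a : A.carrier) (b : B.carrier) :
    tmul a (c • b) = c • tmul a b := tm_smul_right c a b

lemma tmul_zero_left (b : B.carrier) : tmul (0 : A.carrier) b = 0 := tm_zero_left A B b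

lemma tmul_mul_tmul {p q : ℤ × ℤ} (a : A.carrier) {b : B.carrier} (hb : b ∈ B.gr p)
    {a' : A.carrier} (ha' : a' ∈ A.gr q) (b' : B.carrier) :
    tmul a b * tmul a' b' = ksign (totalDeg p * totalDeg q) • tmul (a * a') (b * b') :=
  tm_mul_tm a hb ha' b'

lemma tensor_ext {N : Type*} [AddCommGroup N] [Module ℂ N]
    {f g : (tensor A B).carrier →ₗ[ℂ] N}
    (h : ∀ i, ∀ a ∈ A.gr i, ∀ j, ∀ b ∈ B.gr j, f (tmul a b) = g (tmul a b)) : f = g :=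
  t_ext A B h

lemma tensor_del_tmul {p : ℤ × ℤ} {a : A.carrier} (ha : a ∈ A.gr p) (b : B.carrier) :
    (tensor A B).del (tmul a b) =
      tmul (A.del a) b + ksign (totalDeg p) • tmul a (B.del b) :=
  tdiff_tm _ _ ha b

lemma tensor_delbar_tmul {p : ℤ × ℤ} {a : A.carrier} (ha : a ∈ A.gr p) (b : B.carrier) :
    (tensor A B).delbar (tmul a b) =
      tmul (A.delbar a) b + ksign (totalDeg p) • tmul a (B.delbar b) :=
  tdiff_tm _ _ ha b

/-- The linear map `a ⊗ b ↦ f a * g b`. -/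
def tensorLiftLin (f : A.carrier →ₗ[ℂ] C.carrier) (g : B.carrier →ₗ[ℂ] C.carrier) :
    (tensor A B).carrier →ₗ[ℂ] C.carrier := LinearMap.mul' ℂ C.carrier ∘ₗ tmap A B f g

lemma tensorLiftLin_tmul (f : A.carrier →ₗ[ℂ] C.carrier) (g : B.carrier →ₗ[ℂ] C.carrier)
    (a : A.carrier) (b : B.carrier) : tensorLiftLin f g (tmul a b) = f a * g b :=
  (congrArg (LinearMap.mul' ℂ C.carrier) (tmap_tm f g a b)).trans (LinearMap.mul'_apply ..)

lemma tensorLiftLin_mul (f : Hom A C) (g : Hom B C) (x y : (tensor A B).carrier) :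
    tensorLiftLin f.toAlgHom.toLinearMap g.toAlgHom.toLinearMap (x * y) =
      tensorLiftLin f.toAlgHom.toLinearMap g.toAlgHom.toLinearMap x *
        tensorLiftLin f.toAlgHom.toLinearMap g.toAlgHom.toLinearMap y := by
  set F := tensorLiftLin f.toAlgHom.toLinearMap g.toAlgHom.toLinearMap with hF
  have h : F ∘ₗ LinearMap.mulRight ℂ y = LinearMap.mulRight ℂ (F y) ∘ₗ F := by
    refine tensor_ext fun i a ha j b hb => ?_
    have h' : F ∘ₗ LinearMap.mulLeft ℂ (tmul a b) =
        LinearMap.mulLeft ℂ (F (tmul a b)) ∘ₗ F := by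
      refine tensor_ext fun i' a' ha' j' b' hb' => ?_
      simp only [LinearMap.comp_apply, LinearMap.mulLeft_apply]
      rw [tmul_mul_tmul a hb ha', map_smul, hF, tensorLiftLin_tmul, tensorLiftLin_tmul,
        tensorLiftLin_tmul]
      simp only [AlgHom.toLinearMap_apply, map_mul]
      -- The Koszul sign of the tensor product cancels the sign from exchanging `g b` and `f a'` in
      -- the graded-commutative `C`.
      rw [mul_assoc, ← mul_assoc (f a'), C.mul_comm_of_mem (f.map_mem ha') (g.map_mem hb),
        smul_mul_assoc, mul_smul_comm, smul_smul, mul_comm (totalDeg i'), ksign_mul_self, one_smul]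
      simp only [mul_assoc]
    exact LinearMap.congr_fun h' y
  exact LinearMap.congr_fun h x

/-- The morphism `a ⊗ b ↦ f a * g b` out of the tensor product. -/
def tensorLift (f : Hom A C) (g : Hom B C) : Hom (tensor A B) C where
  toAlgHom := AlgHom.ofLinearMap (tensorLiftLin f.toAlgHom.toLinearMap g.toAlgHom.toLinearMap)
    ((tensorLiftLin_tmul _ _ 1 1).trans (by simp)) (tensorLiftLin_mul f g)
  map_mem {p x} hx := by
    refine tgr_induction A B ((C.gr p).comap (tensorLiftLin _ _)) ?_ hx
    rintro i j rfl a ha b hb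
    change tensorLiftLin f.toAlgHom.toLinearMap g.toAlgHom.toLinearMap (tmul a b) ∈ C.gr (i + j)
    rw [tensorLiftLin_tmul]
    exact mul_mem_gr (f.map_mem ha) (g.map_mem hb)
  map_del x := by
    refine LinearMap.congr_fun (f := tensorLiftLin f.toAlgHom.toLinearMap g.toAlgHom.toLinearMap
      ∘ₗ (tensor A B).del) (g := C.del ∘ₗ tensorLiftLin _ _)
      (tensor_ext fun i a ha j b hb => ?_) x
    simp only [LinearMap.comp_apply]
    rw [tensor_del_tmul ha, map_add, map_smul]
    simp only [tensorLiftLin_tmul, AlgHom.toLinearMap_apply]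
    rw [C.del_mul _ (f.map_mem ha), f.map_del, g.map_del]
  map_delbar x := by
    refine LinearMap.congr_fun (f := tensorLiftLin f.toAlgHom.toLinearMap g.toAlgHom.toLinearMap
      ∘ₗ (tensor A B).delbar) (g := C.delbar ∘ₗ tensorLiftLin _ _)
      (tensor_ext fun i a ha j b hb => ?_) x
    simp only [LinearMap.comp_apply]
    rw [tensor_delbar_tmul ha, map_add, map_smul]
    simp only [tensorLiftLin_tmul, AlgHom.toLinearMap_apply]
    rw [C.delbar_mul _ (f.map_mem ha), f.map_delbar, g.map_delbar]

lemma tensorLift_tmul (f : Hom A C) (g : Hom B C) (a : A.carrier) (b : B.carrier) :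
    tensorLift f g (tmul a b) = f a * g b := tensorLiftLin_tmul _ _ a b

end tensor

/-! ### The path object -/

section path
variable (B : CBBA.{u})

/-- The evaluation `Ω ⊗ B → B` at `s` as a morphism of cbba's. -/
def evalPath (s : ℂ) : Hom (tensor Omega B) B :=
  tensorLift (B.unit.comp (Omega.evalHom s)) (Hom.id B)

lemma evalPath_tmul (s : ℂ) (ω : Omega.carrier) (b : B.carrier) :
    B.evalPath s (tmul ω b) = Omega.eval s ω • b :=
  (tensorLift_tmul _ _ ω b).trans (Algebra.smul_def (Omega.eval s ω : ℂ) b).symm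

lemma evalPath_eq (s : ℂ) (x : (tensor Omega B).carrier) :
    B.evalPath s x = B.evalTensor s x := by
  refine LinearMap.congr_fun (f := (B.evalPath s).toAlgHom.toLinearMap) (g := B.evalTensor s)
    (tensor_ext fun i a _ j b _ => ?_) x
  exact (B.evalPath_tmul s a b).trans (B.evalTensor_tm s a b).symm

/-- The constant path `b ↦ 1 ⊗ b`. -/
def constPath : B.carrier →ₗ[ℂ] (tensor Omega B).carrier where
  toFun b := tmul (1 : Omega.carrier) b
  map_add' := tmul_add_right 1
  map_smul' c b := tmul_smul_right c 1 b

lemma constPath_apply (b : B.carrier) : B.constPath b = tmul (1 : Omega.carrier) b := rfl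

lemma evalPath_constPath (s : ℂ) (b : B.carrier) : B.evalPath s (B.constPath b) = b := by
  rw [constPath_apply, evalPath_tmul, map_one, one_smul]

lemma del_constPath (b : B.carrier) :
    (tensor Omega B).del (B.constPath b) = B.constPath (B.del b) := by
  rw [constPath_apply, tensor_del_tmul one_mem_gr, del_one, tmul_zero_left, zero_add,
    ksign_even (by decide), one_smul, constPath_apply]

lemma delbar_constPath (b : B.carrier) :
    (tensor Omega B).delbar (B.constPath b) = B.constPath (B.delbar b) := by
  rw [constPath_apply, tensor_delbar_tmul one_mem_gr, delbar_one, tmul_zero_left, zero_add,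
    ksign_even (by decide), one_smul, constPath_apply]

/-- The contraction of the path object onto the constant paths. -/
def pathContraction : (tensor Omega B).carrier →ₗ[ℂ] (tensor Omega B).carrier :=
  tend Omega B Omega.contraction LinearMap.id

lemma pathContraction_tmul (ω : Omega.carrier) (b : B.carrier) :
    B.pathContraction (tmul ω b) = tmul (Omega.contraction ω) b := tend_tm _ _ ω b

/-- The contraction identity of `Ω` survives tensoring with `B`. The contraction has even total
degree and so commutes with `1 ⊗ ∂̄`, while `k = ∂̄h - h∂̄` is odd and anticommutes with the
Koszul-signed `1 ⊗ ∂`; the differentials of `B` therefore drop out. -/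
lemma pathContraction_spec (x : (tensor Omega B).carrier) :
    (tensor Omega B).del ((tensor Omega B).delbar (B.pathContraction x) -
        B.pathContraction ((tensor Omega B).delbar x)) +
      ((tensor Omega B).delbar (B.pathContraction ((tensor Omega B).del x)) -
        B.pathContraction ((tensor Omega B).delbar ((tensor Omega B).del x))) =
      x - B.constPath (B.evalPath 0 x) := by
  let k : Omega.carrier →ₗ[ℂ] Omega.carrier :=
    Omega.delbar ∘ₗ Omega.contraction - Omega.contraction ∘ₗ Omega.delbar
  let K : (tensor Omega B).carrier →ₗ[ℂ] (tensor Omega B).carrier := tend Omega B k LinearMap.id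
  have hk : ∀ {p a}, a ∈ Omega.gr p → k a ∈ Omega.gr (p + (-1, 0)) := by
    intro p a ha
    have h1 := Omega.delbar_mem (Omega.contraction_mem ha)
    have h2 := Omega.contraction_mem (Omega.delbar_mem ha)
    rw [add_assoc] at h1 h2
    exact Submodule.sub_mem _ h1 h2
  have hKt : ∀ a b, K (tmul a b) = tmul (k a) b := fun a b => tend_tm _ _ a b
  have h1 : ∀ x, (tensor Omega B).delbar (B.pathContraction x) -
      B.pathContraction ((tensor Omega B).delbar x) = K x := by
    refine LinearMap.congr_fun (f := (tensor Omega B).delbar ∘ₗ B.pathContraction -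
      B.pathContraction ∘ₗ (tensor Omega B).delbar) (tensor_ext fun i a ha j b hb => ?_)
    rw [LinearMap.sub_apply, LinearMap.comp_apply, LinearMap.comp_apply, hKt,
      tensor_delbar_tmul ha, pathContraction_tmul, tensor_delbar_tmul (Omega.contraction_mem ha),
      map_add, map_smul, pathContraction_tmul, pathContraction_tmul, totalDeg_add, ksign_add,
      ksign_even (n := totalDeg (-1, -1)) (by decide), mul_one, add_sub_add_right_eq_sub,
      sub_eq_iff_eq_add, ← tmul_add_left]
    simp [k]
  have h2 : ∀ x, (tensor Omega B).del (K x) + K ((tensor Omega B).del x) =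
      x - B.constPath (B.evalPath 0 x) := by
    refine LinearMap.congr_fun (f := (tensor Omega B).del ∘ₗ K + K ∘ₗ (tensor Omega B).del)
      (g := LinearMap.id - B.constPath ∘ₗ (B.evalPath 0).toAlgHom.toLinearMap)
      (tensor_ext fun i a ha j b hb => ?_)
    simp only [LinearMap.add_apply, LinearMap.sub_apply, LinearMap.comp_apply,
      LinearMap.id_apply, AlgHom.toLinearMap_apply]
    rw [hKt, tensor_del_tmul ha, tensor_del_tmul (hk ha), map_add, map_smul, hKt, hKt,
      totalDeg_add, ksign_add, ksign_odd (n := totalDeg (-1, 0)) (by decide), evalPath_tmul,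
      eq_sub_iff_add_eq, map_smul, constPath_apply]
    have h := eq_add_of_sub_eq (Omega.contraction_spec a).symm
    change a = Omega.del (k a) + k (Omega.del a) + _ at h
    conv_rhs => rw [h]
    rw [tmul_add_left, tmul_add_left, Algebra.algebraMap_eq_smul_one, tmul_smul_left]
    module
  rw [h1, h1, h2]

end path

/-! ### Weak equivalences -/

section weakEquiv
variable {A : CBBA.{u}} {B : CBBA.{v}} {C : CBBA.{w}}

lemma Hom.mapHBC_comp (g : Hom B C) (f : Hom A B) :
    ⇑(g.comp f).mapHBC = g.mapHBC ∘ f.mapHBC := by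
  funext z
  induction z using Submodule.Quotient.induction_on
  rfl

lemma Hom.mapHA_comp (g : Hom B C) (f : Hom A B) :
    ⇑(g.comp f).mapHA = g.mapHA ∘ f.mapHA := by
  funext z
  induction z using Submodule.Quotient.induction_on
  rfl

lemma Hom.IsWeakEquiv.of_comp {g : Hom B C} {f : Hom A B} (hg : g.IsWeakEquiv)
    (h : (g.comp f).IsWeakEquiv) : f.IsWeakEquiv := by
  refine ⟨(Function.Bijective.of_comp_iff' hg.1 _).1 ?_,
    (Function.Bijective.of_comp_iff' hg.2 _).1 ?_⟩
  · rw [← Hom.mapHBC_comp]; exact h.1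
  · rw [← Hom.mapHA_comp]; exact h.2

lemma Hom.isWeakEquiv_id (A : CBBA.{u}) : (Hom.id A).IsWeakEquiv := by
  have h1 : ⇑(Hom.id A).mapHBC = _root_.id := by
    funext z
    induction z using Submodule.Quotient.induction_on
    rfl
  have h2 : ⇑(Hom.id A).mapHA = _root_.id := by
    funext z
    induction z using Submodule.Quotient.induction_on
    rfl
  exact ⟨h1 ▸ Function.bijective_id, h2 ▸ Function.bijective_id⟩

/-- A weak equivalence is injective in Bott--Chern cohomology. -/
lemma Hom.IsWeakEquiv.exists_del_delbar {f : Hom A B} (hf : f.IsWeakEquiv) {a : A.carrier}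
    (h1 : A.del a = 0) (h2 : A.delbar a = 0) {b : B.carrier} (hb : f a = B.del (B.delbar b)) :
    ∃ a', A.del (A.delbar a') = a := by
  have h : f.mapHBC (Submodule.Quotient.mk ⟨a, h1, h2⟩) = f.mapHBC 0 := by
    rw [map_zero]
    refine (Submodule.Quotient.mk_eq_zero _).2 ?_
    exact ⟨b, hb.symm⟩
  exact (Submodule.Quotient.mk_eq_zero _).1 (hf.1.1 h)

/-- A weak equivalence is surjective in Aeppli cohomology. -/
lemma Hom.IsWeakEquiv.exists_aeppli {f : Hom A B} (hf : f.IsWeakEquiv) {b : B.carrier}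
    (hb : B.del (B.delbar b) = 0) :
    ∃ z r s, A.del (A.delbar z) = 0 ∧ b = f z + (B.del r + B.delbar s) := by
  obtain ⟨z, hz⟩ := hf.2.2 (Submodule.Quotient.mk ⟨b, hb⟩)
  induction z using Submodule.Quotient.induction_on with
  | H z =>
    have h := (Submodule.Quotient.eq _).1 hz.symm
    obtain ⟨_, ⟨r, rfl⟩, _, ⟨s, rfl⟩, hrs⟩ := Submodule.mem_sup.1 (Submodule.mem_comap.1 h)
    refine ⟨z, r, s, z.2, ?_⟩
    rw [hrs]
    change b = f z + (b - f z)
    abel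

/-- The kernel of a surjective weak equivalence is acyclic. -/
lemma Hom.IsWeakEquiv.exists_of_mem_ker {f : Hom A B} (hf : f.IsWeakEquiv)
    (hsurj : ∀ b, ∃ a, f a = b) {c : A.carrier} (hc : f c = 0) (h1 : A.del c = 0)
    (h2 : A.delbar c = 0) : ∃ a, f a = 0 ∧ A.del (A.delbar a) = c := by
  -- Bott--Chern injectivity provides a primitive `a`, but `f a` need not vanish. It is
  -- `∂∂̄`-closed, so Aeppli surjectivity and lifts of `r`, `s` supply a correction of `a` that
  -- `∂∂̄` does not see.
  obtain ⟨a, rfl⟩ := hf.exists_del_delbar h1 h2 (b := 0) (by rw [hc, map_zero, map_zero])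
  rw [f.map_del, f.map_delbar] at hc
  obtain ⟨z, r, s, hz, hrs⟩ := hf.exists_aeppli hc
  obtain ⟨r, rfl⟩ := hsurj r
  obtain ⟨s, rfl⟩ := hsurj s
  refine ⟨a - z - (A.del r + A.delbar s), ?_, ?_⟩
  · rw [map_sub, map_sub, map_add, f.map_del, f.map_delbar, hrs]; abel
  · rw [map_sub, map_sub, map_add, map_sub, map_sub, map_add, hz, delbar_del, map_neg, A.del_del,
      A.delbar_delbar, map_zero]
    abel

/-- The linear map underlying a homotopy. -/
def homotopyMap (H : Hom A (tensor Omega B)) : A.carrier →ₗ[ℂ] B.carrier :=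
  (B.evalPath 1).toAlgHom.toLinearMap ∘ₗ B.pathContraction ∘ₗ H.toAlgHom.toLinearMap

lemma homotopyMap_apply (H : Hom A (tensor Omega B)) (a : A.carrier) :
    homotopyMap H a = B.evalPath 1 (B.pathContraction (H a)) := rfl

/-- Evaluate the contraction identity for `H a` at `t = 1`; the constant path at `H a (0)`
contributes the other end point. -/
lemma homotopyMap_spec (H : Hom A (tensor Omega B)) (a : A.carrier) :
    B.evalPath 1 (H a) - B.evalPath 0 (H a) =
      B.del (B.delbar (homotopyMap H a)) - B.del (homotopyMap H (A.delbar a)) +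
        B.delbar (homotopyMap H (A.del a)) + homotopyMap H (A.del (A.delbar a)) := by
  have h := congrArg (B.evalPath 1) (B.pathContraction_spec (H a))
  conv_rhs at h => rw [map_sub, evalPath_constPath]
  rw [← h]
  simp only [map_add, map_sub, Hom.map_del, Hom.map_delbar, homotopyMap_apply, delbar_del, map_neg]
  abel

lemma Homotopic.exists_homotopyMap {f g : Hom A B} (h : Homotopic f g) :
    ∃ κ : A.carrier →ₗ[ℂ] B.carrier, ∀ a, g a - f a =
      B.del (B.delbar (κ a)) - B.del (κ (A.delbar a)) + B.delbar (κ (A.del a)) +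
        κ (A.del (A.delbar a)) := by
  obtain ⟨H, h0, h1⟩ := h
  refine ⟨homotopyMap H, fun a => ?_⟩
  rw [← homotopyMap_spec, evalPath_eq, evalPath_eq, h0, h1]

/-- Of the four terms in the homotopy formula only `∂∂̄κ` survives on `ker ∂ ∩ ker ∂̄`. On `ker ∂∂̄`
the last term vanishes and the others lie in `im ∂ + im ∂̄`. Thus `f` and `g` induce the same maps
on both cohomologies. -/
lemma Homotopic.isWeakEquiv {f g : Hom A B} (h : Homotopic f g) (hg : g.IsWeakEquiv) :
    f.IsWeakEquiv := by
  obtain ⟨κ, hκ⟩ := h.exists_homotopyMap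
  have h1 : g.mapHBC = f.mapHBC := by
    ext z
    obtain ⟨h1, h2⟩ := z.2
    have h1 : A.del z = 0 := h1
    have h2 : A.delbar z = 0 := h2
    refine (Submodule.Quotient.eq _).2 ⟨κ z, ?_⟩
    refine Eq.trans ?_ (hκ z).symm
    simp [h1, h2]
  have h2 : g.mapHA = f.mapHA := by
    ext z
    have h : A.del (A.delbar z) = 0 := z.2
    refine (Submodule.Quotient.eq _).2 (Submodule.mem_comap.2 ?_)
    refine Submodule.mem_sup.2 ⟨_, ⟨B.delbar (κ z) - κ (A.delbar z), rfl⟩, _,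
      ⟨κ (A.del z), rfl⟩, ?_⟩
    refine Eq.trans ?_ (hκ z).symm
    rw [h, map_zero, map_sub, add_zero]
  exact ⟨h1 ▸ hg.1, h2 ▸ hg.2⟩

end weakEquiv

/-! ### Lifting up to homotopy -/

/-- The properties of a subalgebra `W` of `Ω ⊗ A` that allow lifting along weak equivalences up to
homotopies in `W`. -/
structure IsPathSubalgebra (A : CBBA.{u}) (W : Subalgebra ℂ (tensor Omega A).carrier) :
    Prop where
  isSubBicomplex : (tensor Omega A).IsSubBicomplex W.toSubmodule
  constPath_mem : ∀ a, A.constPath a ∈ W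
  pathContraction_mem : ∀ x ∈ W, A.pathContraction x ∈ W
  exists_var_mem : ∀ a, ∃ c : ℂ, tmul Omega.var (a - algebraMap ℂ A.carrier c) ∈ W

lemma isPathSubalgebra_top (A : CBBA.{u}) : A.IsPathSubalgebra ⊤ where
  isSubBicomplex := ⟨fun _ _ => trivial, fun _ _ => trivial, fun _ _ _ => trivial⟩
  constPath_mem _ := trivial
  pathContraction_mem _ _ := trivial
  exists_var_mem _ := ⟨0, trivial⟩

/-- Every element is the difference of the end points of a path that starts at `0`, up to a
constant. -/
lemma IsPathSubalgebra.exists_path {A : CBBA.{u}} {W : Subalgebra ℂ (tensor Omega A).carrier}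
    (hW : A.IsPathSubalgebra W) (a : A.carrier) :
    ∃ x ∈ W, ∃ c : ℂ, A.evalPath 0 x = 0 ∧ A.evalPath 1 x + algebraMap ℂ A.carrier c = a := by
  -- The path is `t ⊗ (a - c)`. The constant is needed for the augmented `W`, where `t ⊗ a` is
  -- allowed only for `a ∈ A⁺`; both differentials kill it.
  obtain ⟨c, hc⟩ := hW.exists_var_mem a
  refine ⟨_, hc, c, ?_, ?_⟩
  · rw [evalPath_tmul, Omega.eval_var, zero_smul]
  · rw [evalPath_tmul, Omega.eval_var, one_smul, sub_add_cancel]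

lemma IsPathSubalgebra.exists_of_closed {A : CBBA.{u}}
    {W : Subalgebra ℂ (tensor Omega A).carrier} (hW : A.IsPathSubalgebra W)
    {x : (tensor Omega A).carrier} (hx : x ∈ W) (h1 : (tensor Omega A).del x = 0)
    (h2 : (tensor Omega A).delbar x = 0) :
    ∃ y ∈ W, (tensor Omega A).del ((tensor Omega A).delbar y) =
      x - A.constPath (A.evalPath 0 x) := by
  refine ⟨A.pathContraction x, hW.pathContraction_mem x hx, ?_⟩
  rw [← A.pathContraction_spec x, h1, h2]
  simp

/-- A morphism out of a nilpotent cbba lifts through a weak equivalence up to homotopy. -/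
theorem exists_homotopy_lift {M : CBBA.{u}} (hM : M.IsNilpotent) {N : CBBA.{v}} {A : CBBA.{w}}
    {W : Subalgebra ℂ (tensor Omega A).carrier} (hW : A.IsPathSubalgebra W) {ψ : Hom N A}
    (hψ : ψ.IsWeakEquiv) (φ : Hom M A) :
    ∃ (f : Hom M N) (H : Hom M (tensor Omega A)), (∀ m, A.evalPath 0 (H m) = ψ (f m)) ∧
      (∀ m, A.evalPath 1 (H m) = φ m) ∧ ∀ m, H m ∈ W := by
  let Ω := tensor Omega A
  let C := prod N Ω
  let π₁ : Hom C N := fst N Ω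
  let π₂ : Hom C Ω := snd N Ω
  -- The path fibration of `ψ`: pairs of a point `n` of `N` and a path in `W` that starts at `ψ n`.
  -- A lift of `φ` along the end point map is a morphism to `N` together with the desired homotopy.
  let V : Subalgebra ℂ C.carrier :=
    AlgHom.equalizer (ψ.comp π₁).toAlgHom ((A.evalPath 0).comp π₂).toAlgHom ⊓ W.comap π₂.toAlgHom
  have hV : ∀ c, c ∈ V ↔ ψ c.1 = A.evalPath 0 c.2 ∧ c.2 ∈ W := fun c => Iff.rfl
  have hVs : C.IsSubBicomplex V.toSubmodule := by
    refine ⟨fun c hc => ?_, fun c hc => ?_, fun q c hc => ?_⟩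
    · obtain ⟨h, h'⟩ := (hV c).1 hc
      refine (hV _).2 ⟨?_, hW.isSubBicomplex.del_mem _ h'⟩
      change ψ (N.del c.1) = A.evalPath 0 (Ω.del c.2)
      rw [ψ.map_del, Hom.map_del, h]
    · obtain ⟨h, h'⟩ := (hV c).1 hc
      refine (hV _).2 ⟨?_, hW.isSubBicomplex.delbar_mem _ h'⟩
      change ψ (N.delbar c.1) = A.evalPath 0 (Ω.delbar c.2)
      rw [ψ.map_delbar, Hom.map_delbar, h]
    · obtain ⟨h, h'⟩ := (hV c).1 hc
      have e1 : (C.component q c).1 = N.component q c.1 := π₁.map_component q c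
      have e2 : (C.component q c).2 = Ω.component q c.2 := π₂.map_component q c
      refine (hV _).2 ⟨?_, ?_⟩
      · rw [e1, e2, ψ.map_component, Hom.map_component, h]
      · rw [e2]; exact hW.isSubBicomplex.component_mem q _ h'
  obtain ⟨F, hFV, hF⟩ := exists_lift hM ((A.evalPath 1).comp π₂) V hVs
    (fun a => by
      obtain ⟨x, hx, c, h0, h1⟩ := hW.exists_path a
      -- The path from `c` to `a` obtained by adding the constant path `c`; it starts at the image
      -- of `c` from `N`.
      refine ⟨(algebraMap ℂ N.carrier c, x + algebraMap ℂ Ω.carrier c), (hV _).2 ⟨?_, ?_⟩, ?_⟩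
      · rw [map_add, h0, AlgHom.commutes, AlgHom.commutes, zero_add]
      · exact W.add_mem hx (W.algebraMap_mem c)
      · change A.evalPath 1 (x + algebraMap ℂ Ω.carrier c) = a
        rw [map_add, AlgHom.commutes, h1])
    (fun c hc h0 h1 h2 => by
      obtain ⟨n, x⟩ := c
      obtain ⟨hn, hxW⟩ := (hV _).1 hc
      have h0 : A.evalPath 1 x = 0 := h0
      have h1n : N.del n = 0 := congrArg Prod.fst h1
      have h1x : Ω.del x = 0 := congrArg Prod.snd h1
      have h2n : N.delbar n = 0 := congrArg Prod.fst h2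
      have h2x : Ω.delbar x = 0 := congrArg Prod.snd h2
      obtain ⟨y, hyW, hy⟩ := hW.exists_of_closed hxW h1x h2x
      rw [← hn] at hy
      -- Normalise `y` to start at `0`. This keeps `∂∂̄y`, because applying evaluation at `0` to
      -- `hy` shows that the starting point is `∂∂̄`-closed.
      replace hyW := W.sub_mem hyW (hW.constPath_mem (A.evalPath 0 y))
      have hy' : Ω.del (Ω.delbar (y - A.constPath (A.evalPath 0 y))) =
          x - A.constPath (ψ n) := by
        have h := congrArg (A.evalPath 0) hy
        rw [Hom.map_del, Hom.map_delbar, map_sub, evalPath_constPath, ← hn, sub_self] at h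
        rw [map_sub, map_sub, hy, delbar_constPath, del_constPath, h, map_zero, sub_zero]
      have hy0 : A.evalPath 0 (y - A.constPath (A.evalPath 0 y)) = 0 := by
        rw [map_sub, evalPath_constPath, sub_self]
      generalize y - A.constPath (A.evalPath 0 y) = y at hyW hy' hy0
      have hy1 : A.del (A.delbar (A.evalPath 1 y)) = - ψ n := by
        have h := congrArg (A.evalPath 1) hy'
        rwa [Hom.map_del, Hom.map_delbar, map_sub, evalPath_constPath, h0, zero_sub] at h
      -- The end point of `y` exhibits `ψ n` as `∂∂̄`-exact, so `n = ∂∂̄n₁`. The path `const (ψ n₁)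
      -- + y` then has the right `∂∂̄`, but its end point is only `∂∂̄`-closed.
      obtain ⟨n₁, hn₁⟩ := hψ.exists_del_delbar h1n h2n (b := - A.evalPath 1 y)
        (by rw [map_neg, map_neg, hy1, neg_neg])
      obtain ⟨z, r, s, hz, hrs⟩ := hψ.exists_aeppli (b := ψ n₁ + A.evalPath 1 y)
        (by rw [map_add, map_add, hy1, ← ψ.map_delbar, ← ψ.map_del, hn₁, add_neg_cancel])
      -- Aeppli surjectivity writes that end point as `ψ z + ∂r + ∂̄s`. Moving `n₁` by `z` and
      -- subtracting the differentials of paths from `0` to `r` and `s`, up to constants, makes it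
      -- vanish without changing the starting condition or `∂∂̄`.
      obtain ⟨r', hr', a, hr0, hr1⟩ := hW.exists_path r
      obtain ⟨s', hs', b, hs0, hs1⟩ := hW.exists_path s
      have hr : A.del (A.evalPath 1 r') = A.del r := by
        rw [← hr1, map_add, del_algebraMap, add_zero]
      have hs : A.delbar (A.evalPath 1 s') = A.delbar s := by
        rw [← hs1, map_add, delbar_algebraMap, add_zero]
      refine ⟨(n₁ - z, A.constPath (ψ (n₁ - z)) + y - (Ω.del r' + Ω.delbar s')),
        (hV _).2 ⟨?_, ?_⟩, ?_, Prod.ext ?_ ?_⟩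
      · change ψ (n₁ - z) =
          A.evalPath 0 (A.constPath (ψ (n₁ - z)) + y - (Ω.del r' + Ω.delbar s'))
        rw [map_sub (A.evalPath 0).toAlgHom, map_add, map_add, Hom.map_del, Hom.map_delbar,
          evalPath_constPath, hy0, hr0,
          hs0, map_zero, map_zero, add_zero, add_zero, sub_zero]
      · exact W.sub_mem (W.add_mem (hW.constPath_mem _) hyW)
          (W.add_mem (hW.isSubBicomplex.del_mem _ hr') (hW.isSubBicomplex.delbar_mem _ hs'))
      · change A.evalPath 1 (A.constPath (ψ (n₁ - z)) + y - (Ω.del r' + Ω.delbar s')) = 0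
        rw [map_sub, map_add, map_add, Hom.map_del, Hom.map_delbar, evalPath_constPath, hr, hs,
          map_sub, sub_add_eq_add_sub, hrs]
        abel
      · change N.del (N.delbar (n₁ - z)) = n
        rw [map_sub, map_sub, hz, hn₁, sub_zero]
      · change Ω.del (Ω.delbar (A.constPath (ψ (n₁ - z)) + y - (Ω.del r' + Ω.delbar s'))) = x
        rw [map_sub, map_add, map_add, map_sub, map_add, map_add, hy', delbar_constPath,
          del_constPath, ← ψ.map_delbar, ← ψ.map_del, map_sub, map_sub, hz, hn₁, sub_zero,
          delbar_del, map_neg, Ω.del_del, Ω.delbar_delbar, map_zero]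
        abel) φ
  exact ⟨π₁.comp F, π₂.comp F, fun m => ((hV _).1 (hFV m)).1.symm, hF, fun m => ((hV _).1 (hFV m)).2⟩

/-! ### Paths with values in an ideal -/

section pathSpan
variable {B : CBBA.{u}}

/-- The subspace `Ω ⊗ J` of `Ω ⊗ B`. -/
def pathSpan (J : Submodule ℂ B.carrier) : Submodule ℂ (tensor Omega B).carrier :=
  Submodule.span ℂ {x | ∃ ω : Omega.carrier, ∃ b ∈ J, x = tmul ω b}

lemma tmul_mem_pathSpan {J : Submodule ℂ B.carrier} (ω : Omega.carrier) {b : B.carrier}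
    (hb : b ∈ J) : tmul ω b ∈ pathSpan J :=
  Submodule.subset_span ⟨ω, b, hb, rfl⟩

lemma pathContraction_mem_pathSpan {J : Submodule ℂ B.carrier} {x : (tensor Omega B).carrier}
    (hx : x ∈ pathSpan J) : B.pathContraction x ∈ pathSpan J := by
  have h : pathSpan J ≤ (pathSpan J).comap B.pathContraction := by
    refine Submodule.span_le.2 ?_
    rintro _ ⟨ω, b, hb, rfl⟩
    rw [SetLike.mem_coe, Submodule.mem_comap, pathContraction_tmul]
    exact tmul_mem_pathSpan _ hb
  exact h hx

lemma evalPath_mem {J : Submodule ℂ B.carrier} (s : ℂ) {x : (tensor Omega B).carrier}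
    (hx : x ∈ pathSpan J) : B.evalPath s x ∈ J := by
  have h : pathSpan J ≤ J.comap (B.evalPath s).toAlgHom.toLinearMap := by
    refine Submodule.span_le.2 ?_
    rintro _ ⟨ω, b, hb, rfl⟩
    change B.evalPath s (tmul ω b) ∈ J
    rw [evalPath_tmul]
    exact J.smul_mem _ hb
  exact h hx

/-- Moving a form past an element of `B` changes the latter at most by its parity. -/
lemma tmul_mul_tmul_of_mem {A : CBBA.{v}} {q : ℤ × ℤ} (a : A.carrier) (b : B.carrier)
    {a' : A.carrier} (ha' : a' ∈ A.gr q) (b' : B.carrier) :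
    tmul a b * tmul a' b' =
      tmul (a * a') ((if Even (totalDeg q) then b else B.par b) * b') := by
  let L : B.carrier →ₗ[ℂ] (tensor A B).carrier :=
    { toFun := fun b => tmul a b
      map_add' := tmul_add_right a
      map_smul' := fun c b => tmul_smul_right c a b }
  let L' : B.carrier →ₗ[ℂ] (tensor A B).carrier :=
    { toFun := fun b => tmul (a * a') b
      map_add' := tmul_add_right _
      map_smul' := fun c b => tmul_smul_right c _ b }
  have h : LinearMap.mulRight ℂ (tmul a' b') ∘ₗ L = L' ∘ₗ LinearMap.mulRight ℂ b' ∘ₗ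
      (if Even (totalDeg q) then LinearMap.id else B.par) := by
    refine B.lin_ext fun p b hb => ?_
    change tmul a b * tmul a' b' = tmul (a * a') ((if Even (totalDeg q) then LinearMap.id
      else B.par : B.carrier →ₗ[ℂ] B.carrier) b * b')
    rw [tmul_mul_tmul a hb ha']
    split_ifs with hq
    · rw [ksign_even (hq.mul_left _), one_smul, LinearMap.id_apply]
    · rw [ksign_mul_of_odd _ (Int.not_even_iff_odd.1 hq), B.par_of_mem hb, smul_mul_assoc,
        tmul_smul_right]
  refine (LinearMap.congr_fun h b).trans ?_
  change tmul (a * a') ((if Even (totalDeg q) then LinearMap.id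
    else B.par : B.carrier →ₗ[ℂ] B.carrier) b * b') = _
  split_ifs <;> rfl

/-- Multiplying pure tensors moves a form past `b`, which replaces `b` by itself or by `B.par b`;
hence the stability of `J` under parity. Only the second form must be split into homogeneous
components. -/
lemma pathSpan_mul_le {J J' : Submodule ℂ B.carrier} (hJ : ∀ b ∈ J, B.par b ∈ J) :
    pathSpan J * pathSpan J' ≤ pathSpan (J * J') := by
  rw [pathSpan, pathSpan, Submodule.span_mul_span, Submodule.span_le]
  rintro _ ⟨_, ⟨ω, b, hb, rfl⟩, _, ⟨ω', b', hb', rfl⟩, rfl⟩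
  let L : Omega.carrier →ₗ[ℂ] (tensor Omega B).carrier :=
    { toFun := fun ω' => tmul ω b * tmul ω' b'
      map_add' := fun x y => by rw [tmul_add_left, mul_add]
      map_smul' := fun c x => by rw [tmul_smul_left, mul_smul_comm]; rfl }
  refine Omega.mem_of_component_mem ((pathSpan (J * J')).comap L) (a := ω') fun q => ?_
  change tmul ω b * tmul (Omega.component q ω') b' ∈ pathSpan (J * J')
  rw [tmul_mul_tmul_of_mem ω b (Omega.component_mem q ω') b']
  refine tmul_mem_pathSpan _ (Submodule.mul_mem_mul ?_ hb')
  split_ifs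
  · exact hb
  · exact hJ b hb

end pathSpan

/-! ### The filtration by total degree -/

section degree
variable (A : CBBA.{u})

/-- The span of the homogeneous elements of total degree at least `k`. -/
def degGE (k : ℕ) : Submodule ℂ A.carrier :=
  Submodule.span ℂ {x | ∃ p, (k : ℤ) ≤ totalDeg p ∧ x ∈ A.gr p}

lemma degGE_mul_le (j k : ℕ) : A.degGE j * A.degGE k ≤ A.degGE (j + k) := by
  rw [degGE, degGE, Submodule.span_mul_span, Submodule.span_le]
  rintro _ ⟨a, ⟨p, hp, ha⟩, b, ⟨q, hq, hb⟩, rfl⟩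
  refine Submodule.subset_span ⟨p + q, ?_, mul_mem_gr ha hb⟩
  rw [totalDeg_add]
  push_cast
  exact add_le_add hp hq

lemma pow_le_degGE {I : Submodule ℂ A.carrier} (hI : I ≤ A.degGE 1) (k : ℕ) :
    I ^ (k + 1) ≤ A.degGE (k + 1) := by
  induction k with
  | zero => simpa using hI
  | succ k ih =>
    rw [pow_succ]
    exact (mul_le_mul' ih hI).trans (A.degGE_mul_le _ _)

lemma component_eq_zero_of_mem_degGE {k : ℕ} {p : ℤ × ℤ} (hp : totalDeg p < k) {a : A.carrier}
    (ha : a ∈ A.degGE k) : A.component p a = 0 := by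
  have h : A.degGE k ≤ LinearMap.ker (A.component p) := by
    refine Submodule.span_le.2 ?_
    rintro x ⟨q, hq, hx⟩
    refine A.component_of_mem_of_ne hx ?_
    rintro rfl
    exact absurd hp (not_lt.2 hq)
  exact h ha

variable {A}

lemma IsConnected.eq_zero_of_neg (hA : A.IsConnected) {p : ℤ × ℤ} (hp : totalDeg p < 0)
    {a : A.carrier} (ha : a ∈ A.gr p) : a = 0 := by
  have h := A.gr_le_tot p ha
  rwa [hA.1 _ hp, Submodule.mem_bot] at h

lemma IsConnected.exists_algebraMap (hA : A.IsConnected) {p : ℤ × ℤ} (hp : totalDeg p = 0)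
    {a : A.carrier} (ha : a ∈ A.gr p) : ∃ c, algebraMap ℂ A.carrier c = a := by
  have h := A.gr_le_tot p ha
  rw [hp, ← hA.2.2] at h
  exact h

end degree

end CBBA

/-! ### Augmentations and the augmented path algebra `ℂ ⊕ Ω ⊗ A⁺` -/

namespace AugCBBA
open CBBA

section
variable (A : AugCBBA.{u})

/-- The augmentation as an algebra map to `ℂ`. -/
def augMap : A.carrier →ₐ[ℂ] ℂ := A.aug.toAlgHom

variable {A}

lemma mem_augIdeal {a : A.carrier} : a ∈ A.augIdeal ↔ A.augMap a = 0 := Iff.rfl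

lemma augMap_of_mem {p : ℤ × ℤ} (hp : p ≠ 0) {a : A.carrier} (ha : a ∈ A.gr p) :
    A.augMap a = 0 := by
  have h : A.augMap a ∈ (if p = 0 then ⊤ else ⊥ : Submodule ℂ ℂ) := A.aug.map_mem ha
  rwa [if_neg hp] at h

lemma augMap_del (a : A.carrier) : A.augMap (A.del a) = 0 := A.aug.map_del a

lemma augMap_delbar (a : A.carrier) : A.augMap (A.delbar a) = 0 := A.aug.map_delbar a

lemma augMap_algebraMap (c : ℂ) : A.augMap (algebraMap ℂ A.carrier c) = c :=
  A.augMap.commutes c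

lemma ne_zero_of_totalDeg_ne_zero {p : ℤ × ℤ} (hp : totalDeg p ≠ 0) : p ≠ 0 := by
  rintro rfl
  exact hp rfl

lemma augMap_par (a : A.carrier) : A.augMap (A.par a) = A.augMap a := by
  refine LinearMap.congr_fun (f := A.augMap.toLinearMap ∘ₗ A.par) (g := A.augMap.toLinearMap)
    (A.lin_ext fun p a ha => ?_) a
  rw [LinearMap.comp_apply, A.par_of_mem ha, map_smul, AlgHom.toLinearMap_apply]
  by_cases hp : p = 0
  · rw [hp, ksign_even (by decide), one_smul]
  · rw [augMap_of_mem hp ha, smul_zero]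

/-- Morphisms out of a connected augmented cbba are compatible with the augmentations. -/
lemma augMap_map_of_isConnected (hA : A.IsConnected) {B : AugCBBA.{v}}
    (f : Hom A.toCBBA B.toCBBA) (a : A.carrier) : B.augMap (f a) = A.augMap a := by
  refine LinearMap.congr_fun (f := B.augMap.toLinearMap ∘ₗ f.toAlgHom.toLinearMap)
    (g := A.augMap.toLinearMap) (A.lin_ext fun p a ha => ?_) a
  simp only [LinearMap.comp_apply, AlgHom.toLinearMap_apply]
  by_cases hp : totalDeg p = 0
  · obtain ⟨c, rfl⟩ := hA.exists_algebraMap hp ha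
    rw [AlgHom.commutes, augMap_algebraMap, augMap_algebraMap]
  · have hp := ne_zero_of_totalDeg_ne_zero hp
    rw [augMap_of_mem hp ha, augMap_of_mem hp (f.map_mem ha)]

lemma isAugHom_of_isConnected (hA : A.IsConnected) {B : AugCBBA.{v}}
    (f : Hom A.toCBBA B.toCBBA) : IsAugHom f :=
  Hom.ext fun a => augMap_map_of_isConnected hA f a

/-- Connectedness leaves only scalars in total degree `0`, and the augmentation is the identity on
them, so an element of `A⁺` has no such component. -/
lemma augIdeal_le_degGE (hA : A.IsConnected) : A.augIdeal ≤ A.degGE 1 := by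
  intro a ha
  refine A.mem_of_component_mem _ fun q => ?_
  have hq := A.component_mem q a
  rcases lt_trichotomy (totalDeg q) 0 with h | h | h
  · rw [hA.eq_zero_of_neg h hq]; exact Submodule.zero_mem _
  · obtain ⟨c, hc⟩ := hA.exists_algebraMap h hq
    have h0 : A.augMap (A.component q a) = base.component q (A.augMap a) :=
      A.aug.map_component q a
    rw [mem_augIdeal.1 ha, ← hc, augMap_algebraMap] at h0
    have hc0 : c = 0 := h0.trans (map_zero (base.component q))
    rw [← hc, hc0, map_zero]
    exact Submodule.zero_mem _
  · exact Submodule.subset_span ⟨q, by exact_mod_cast h, hq⟩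

variable (A)

/-- The morphism `id ⊗ ε : Ω ⊗ A → Ω`. -/
def augPath : Hom (tensor Omega A.toCBBA) Omega :=
  tensorLift (Hom.id Omega) (Omega.unit.comp A.aug)

lemma augPath_tmul (ω : Omega.carrier) (a : A.carrier) :
    A.augPath (tmul ω a) = A.augMap a • ω := by
  refine (tensorLift_tmul _ _ ω a).trans ?_
  rw [Algebra.smul_def]
  exact (Algebra.commutes (A.augMap a) ω).symm

/-- The subalgebra `ℂ ⊕ Ω ⊗ A⁺` of `Ω ⊗ A`. -/
def pathSubalgebra : Subalgebra ℂ (tensor Omega A.toCBBA).carrier :=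
  -- Defined as the paths whose image under `id ⊗ ε` is constant; closure under all the operations
  -- then reduces to facts about constants in `Ω`.
  (⊥ : Subalgebra ℂ Omega.carrier).comap A.augPath.toAlgHom

variable {A}

lemma mem_pathSubalgebra {x : (tensor Omega A.toCBBA).carrier} :
    x ∈ A.pathSubalgebra ↔ ∃ c, algebraMap ℂ Omega.carrier c = A.augPath x :=
  Algebra.mem_bot

lemma augPath_pathContraction (x : (tensor Omega A.toCBBA).carrier) :
    A.augPath (A.pathContraction x) = Omega.contraction (A.augPath x) := by
  refine LinearMap.congr_fun (f := A.augPath.toAlgHom.toLinearMap ∘ₗ A.pathContraction)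
    (g := Omega.contraction ∘ₗ A.augPath.toAlgHom.toLinearMap)
    (tensor_ext fun i a _ j b _ => ?_) x
  simp only [LinearMap.comp_apply, AlgHom.toLinearMap_apply]
  rw [pathContraction_tmul, augPath_tmul, augPath_tmul, map_smul]

lemma eval_augPath (s : ℂ) (x : (tensor Omega A.toCBBA).carrier) :
    Omega.eval s (A.augPath x) = A.augMap (A.evalPath s x) := by
  refine LinearMap.congr_fun
    (f := (Omega.eval s).toLinearMap ∘ₗ A.augPath.toAlgHom.toLinearMap)
    (g := A.augMap.toLinearMap ∘ₗ (A.evalPath s).toAlgHom.toLinearMap)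
    (tensor_ext fun i a _ j b _ => ?_) x
  simp only [LinearMap.comp_apply, AlgHom.toLinearMap_apply]
  rw [evalPath_tmul, augPath_tmul, map_smul, map_smul, smul_eq_mul, smul_eq_mul, mul_comm]

lemma isPathSubalgebra_pathSubalgebra : A.IsPathSubalgebra A.pathSubalgebra where
  isSubBicomplex := by
    refine ⟨fun x hx => ?_, fun x hx => ?_, fun q x hx => ?_⟩
    · obtain ⟨c, hc⟩ := mem_pathSubalgebra.1 hx
      refine mem_pathSubalgebra.2 ⟨0, ?_⟩
      rw [Hom.map_del, ← hc, del_algebraMap, map_zero]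
    · obtain ⟨c, hc⟩ := mem_pathSubalgebra.1 hx
      refine mem_pathSubalgebra.2 ⟨0, ?_⟩
      rw [Hom.map_delbar, ← hc, delbar_algebraMap, map_zero]
    · obtain ⟨c, hc⟩ := mem_pathSubalgebra.1 hx
      by_cases hq : 0 = q
      · refine mem_pathSubalgebra.2 ⟨c, ?_⟩
        rw [Hom.map_component, ← hc, Omega.component_of_mem (hq ▸ algebraMap_mem_gr c)]
      · refine mem_pathSubalgebra.2 ⟨0, ?_⟩
        rw [Hom.map_component, ← hc, Omega.component_of_mem_of_ne (algebraMap_mem_gr c) hq,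
          map_zero]
  constPath_mem a := mem_pathSubalgebra.2 ⟨A.augMap a, by
    rw [constPath_apply, augPath_tmul, Algebra.algebraMap_eq_smul_one]⟩
  pathContraction_mem x hx := by
    obtain ⟨c, hc⟩ := mem_pathSubalgebra.1 hx
    refine mem_pathSubalgebra.2 ⟨0, ?_⟩
    rw [augPath_pathContraction, ← hc, map_zero, Algebra.algebraMap_eq_smul_one, map_smul,
      Omega.contraction_one, smul_zero]
  exists_var_mem a := ⟨A.augMap a, mem_pathSubalgebra.2 ⟨0, by
    rw [augPath_tmul, map_sub, augMap_algebraMap, sub_self, zero_smul, map_zero]⟩⟩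

lemma mem_pathSpan_of_augPath_eq_zero {x : (tensor Omega A.toCBBA).carrier}
    (hx : A.augPath x = 0) : x ∈ pathSpan A.augIdeal := by
  let L : Omega.carrier →ₗ[ℂ] (tensor Omega A.toCBBA).carrier :=
    { toFun := fun ω => tmul ω 1
      map_add' := fun x y => tmul_add_left x y 1
      map_smul' := fun c x => tmul_smul_left c x 1 }
  have h : (pathSpan A.augIdeal).mkQ ∘ₗ
      (LinearMap.id - L ∘ₗ A.augPath.toAlgHom.toLinearMap) = 0 := by
    refine tensor_ext fun i a _ j b _ => ?_
    rw [LinearMap.comp_apply, LinearMap.zero_apply, Submodule.mkQ_apply,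
      Submodule.Quotient.mk_eq_zero]
    change tmul a b - tmul (A.augPath (tmul a b)) 1 ∈ _
    -- Splitting `b` as `(b - ε b) + ε b` exhibits `Ω ⊗ A⁺` as the kernel of `id ⊗ ε`.
    have h : tmul a b - tmul (A.augPath (tmul a b)) 1 =
        tmul a (b - algebraMap ℂ A.carrier (A.augMap b)) := by
      rw [augPath_tmul, tmul_smul_left, ← tmul_smul_right, sub_eq_iff_eq_add, ← tmul_add_right,
        ← Algebra.algebraMap_eq_smul_one, sub_add_cancel]
    rw [h]
    refine tmul_mem_pathSpan _ (mem_augIdeal.2 ?_)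
    rw [map_sub, augMap_algebraMap, sub_self]
  have := LinearMap.congr_fun h x
  rw [LinearMap.comp_apply, LinearMap.zero_apply, Submodule.mkQ_apply,
    Submodule.Quotient.mk_eq_zero] at this
  change x - tmul (A.augPath x) 1 ∈ _ at this
  rwa [hx, tmul_zero_left, sub_zero] at this

/-- The image of `x` under `id ⊗ ε` is a constant, so its value can be read off at a single `s`.
Compatibility with augmentations at one end point thus forces the whole path into `Ω ⊗ A⁺`. -/
lemma mem_pathSpan {x : (tensor Omega A.toCBBA).carrier} (hx : x ∈ A.pathSubalgebra) {s : ℂ}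
    (h : A.augMap (A.evalPath s x) = 0) : x ∈ pathSpan A.augIdeal := by
  obtain ⟨c, hc⟩ := mem_pathSubalgebra.1 hx
  rw [← eval_augPath, ← hc, AlgHom.commutes] at h
  have h : c = 0 := h
  exact mem_pathSpan_of_augPath_eq_zero (by rw [← hc, h, map_zero])

end

/-! ### Weak equivalences of connected minimal cbba's -/

/-- `D` takes all its values in `A⁺`, and parity preserves `A⁺`, so both Leibniz terms are products
of two elements of `A⁺`. -/
lemma mul_augIdeal_closed {A : AugCBBA.{u}} {D : A.carrier →ₗ[ℂ] A.carrier}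
    (hD : ∀ a b, D (a * b) = D a * b + A.par a * D b) (haug : ∀ a, A.augMap (D a) = 0)
    {a : A.carrier} (ha : a ∈ A.augIdeal * A.augIdeal) : D a ∈ A.augIdeal * A.augIdeal := by
  have h : A.augIdeal * A.augIdeal ≤ (A.augIdeal * A.augIdeal).comap D := by
    refine Submodule.mul_le.2 fun a ha b hb => ?_
    rw [Submodule.mem_comap, hD]
    refine Submodule.add_mem _ (Submodule.mul_mem_mul (haug a) hb)
      (Submodule.mul_mem_mul ?_ (haug b))
    rw [mem_augIdeal, augMap_par]
    exact ha
  exact h ha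

/-- A subspace that is covered by a subalgebra modulo its square is covered by it modulo all its
powers. -/
lemma le_sup_pow {R : Type*} [Ring R] [Algebra ℂ R] {I T : Submodule ℂ R} {S : Subalgebra ℂ R}
    (hTI : T ≤ I) (hTS : T ≤ S.toSubmodule) (h : I ≤ T ⊔ I ^ 2) (k : ℕ) :
    I ≤ S.toSubmodule ⊔ I ^ (k + 1) := by
  have hTpow : ∀ k, T ^ (k + 1) ≤ S.toSubmodule := by
    intro k
    induction k with
    | zero => simpa using hTS
    | succ k ih =>
      rw [pow_succ]
      exact Submodule.mul_le.2 fun a ha b hb => S.mul_mem (ih ha) (hTS hb)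
  -- Multiplying `I ≤ T ⊔ I²` by itself replaces each factor `I` by `T` at the cost of one more
  -- power of `I`; the powers of `T` remain inside the subalgebra `S`.
  have hpow : ∀ k, I ^ (k + 1) ≤ T ^ (k + 1) ⊔ I ^ (k + 2) := by
    intro k
    induction k with
    | zero => simpa using h
    | succ k ih =>
      calc I ^ (k + 1 + 1) = I ^ (k + 1) * I := pow_succ _ _
        _ ≤ (T ^ (k + 1) ⊔ I ^ (k + 2)) * I := mul_le_mul' ih le_rfl
        _ = T ^ (k + 1) * I ⊔ I ^ (k + 2) * I := Submodule.sup_mul _ _ _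
        _ ≤ T ^ (k + 1) * (T ⊔ I ^ 2) ⊔ I ^ (k + 3) :=
          sup_le_sup (mul_le_mul' le_rfl h) (pow_succ I (k + 2)).ge
        _ = T ^ (k + 1) * T ⊔ T ^ (k + 1) * I ^ 2 ⊔ I ^ (k + 3) := by rw [Submodule.mul_sup]
        _ ≤ T ^ (k + 2) ⊔ I ^ (k + 3) := by
          refine sup_le (sup_le ((pow_succ T (k + 1)).ge.trans le_sup_left) ?_) le_sup_right
          refine le_trans ?_ le_sup_right
          rw [show k + 3 = k + 1 + 2 by ring, pow_add I (k + 1) 2]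
          exact mul_le_mul' (pow_le_pow_left' hTI _) le_rfl
  induction k with
  | zero => simp
  | succ k ih =>
    refine ih.trans (sup_le le_sup_left ((hpow k).trans (sup_le_sup (hTpow k) le_rfl)))

/-- A weak equivalence onto a connected minimal cbba is surjective. -/
theorem surjective_of_isWeakEquiv {A : CBBA.{u}} {B : AugCBBA.{v}} (hB : B.IsConnected)
    (hmin : B.IsMinimal) {f : Hom A B.toCBBA} (hf : f.IsWeakEquiv) (b : B.carrier) :
    ∃ a, f a = b := by
  obtain ⟨g, H, h0, h1, hW⟩ :=
    exists_homotopy_lift hmin.1 isPathSubalgebra_pathSubalgebra hf (Hom.id B.toCBBA)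
  let u : Hom B.toCBBA B.toCBBA := f.comp g
  have hu : ∀ b, B.augMap (u b) = B.augMap b := augMap_map_of_isConnected hB u
  let I := B.augIdeal
  have hIpar : ∀ b ∈ I, B.par b ∈ I := fun b hb => (augMap_par b).trans hb
  -- This is where the augmented form of the homotopy is needed: multiplicativity of `H` then gives
  -- `H(I²) ⊆ Ω ⊗ I²`, so `κ` preserves `I²` although it is only linear.
  have hH : ∀ b ∈ I, H b ∈ pathSpan I := fun b hb =>
    mem_pathSpan (hW b) (s := 0) (by rw [h0]; exact (hu b).trans hb)
  have hH2 : ∀ b ∈ I * I, H b ∈ pathSpan (I * I) := by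
    have h : I * I ≤ (pathSpan (I * I)).comap H.toAlgHom.toLinearMap := by
      refine Submodule.mul_le.2 fun a ha b hb => ?_
      change H (a * b) ∈ pathSpan (I * I)
      rw [map_mul]
      exact pathSpan_mul_le hIpar (Submodule.mul_mem_mul (hH a ha) (hH b hb))
    exact fun b hb => h hb
  let κ := homotopyMap H
  have hκ : ∀ b ∈ I * I, κ b ∈ I * I := fun b hb =>
    evalPath_mem 1 (pathContraction_mem_pathSpan (hH2 b hb))
  have hspec : ∀ b, b - u b = B.del (B.delbar (κ b)) - B.del (κ (B.delbar b)) +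
      B.delbar (κ (B.del b)) + κ (B.del (B.delbar b)) := fun b => by
    rw [← homotopyMap_spec, h0, h1]; rfl
  have hdd : ∀ b, B.del (B.delbar b) ∈ I * I := fun b => hmin.2 ⟨b, rfl⟩
  have hd : ∀ b ∈ I * I, B.del b ∈ I * I := fun b hb =>
    mul_augIdeal_closed del_mul_par augMap_del hb
  have hb : ∀ b ∈ I * I, B.delbar b ∈ I * I := fun b hb =>
    mul_augIdeal_closed delbar_mul_par augMap_delbar hb
  -- Modulo `I²` the map `id - u` is `-∂κ∂̄ + ∂̄κ∂`. Its image is killed by `∂` and `∂̄` modulo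
  -- `I²`, since each composite contains `∂∂̄` or a squared differential; a second application
  -- therefore lands in `I²`.
  have hsq : ∀ b, (b - u b) - u (b - u b) ∈ I * I := by
    intro b
    have e1 : B.delbar (b - u b) ∈ I * I := by
      rw [hspec, map_add, map_add, map_sub, B.delbar_delbar, delbar_del, delbar_del,
        B.delbar_delbar, map_zero]
      exact Submodule.add_mem _ (Submodule.add_mem _ (Submodule.sub_mem _
        (by simp) (Submodule.neg_mem _ (hdd _))) (Submodule.zero_mem _)) (hb _ (hκ _ (hdd _)))
    have e2 : B.del (b - u b) ∈ I * I := by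
      rw [hspec, map_add, map_add, map_sub, B.del_del, B.del_del]
      exact Submodule.add_mem _ (Submodule.add_mem _ (by simp) (hdd _)) (hd _ (hκ _ (hdd _)))
    rw [hspec (b - u b)]
    exact Submodule.add_mem _ (Submodule.add_mem _ (Submodule.sub_mem _ (hdd _)
      (hd _ (hκ _ e1))) (hb _ (hκ _ e2))) (hκ _ (hdd _))
  let S : Subalgebra ℂ B.carrier := f.toAlgHom.range
  have hS : ∀ q, ∀ s ∈ S, B.component q s ∈ S := by
    rintro q _ ⟨a, rfl⟩
    exact ⟨A.component q a, f.map_component q a⟩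
  have hcover : I ≤ I.map u.toAlgHom.toLinearMap ⊔ I ^ 2 := by
    intro b hb
    have hub : u b ∈ I := (hu b).trans hb
    -- With `e = id - u` this is `id = (id - e)(id + e) + e²`: `u` is inverted modulo `I²` by `id +
    -- e`.
    have h : b = u (b + (b - u b)) + ((b - u b) - u (b - u b)) := by
      rw [map_add]; abel
    rw [h, sq]
    exact Submodule.add_mem_sup
      ⟨_, Submodule.add_mem _ hb (Submodule.sub_mem _ hb hub), rfl⟩ (hsq b)
  have hI : ∀ k, I ≤ S.toSubmodule ⊔ I ^ (k + 1) := le_sup_pow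
    (by
      rintro _ ⟨b, hb, rfl⟩
      exact (hu b).trans hb)
    (by
      rintro _ ⟨b, hb, rfl⟩
      exact ⟨g b, rfl⟩) hcover
  refine B.mem_of_component_mem S.toSubmodule fun q => ?_
  have hq := B.component_mem q b
  generalize B.component q b = b at hq
  rcases lt_trichotomy (totalDeg q) 0 with h | h | h
  · rw [hB.eq_zero_of_neg h hq]; exact Submodule.zero_mem _
  · obtain ⟨c, rfl⟩ := hB.exists_algebraMap h hq
    exact S.algebraMap_mem c
  · obtain ⟨n, hn⟩ := Int.eq_ofNat_of_zero_le h.le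
    have hbI : b ∈ I := augMap_of_mem (ne_zero_of_totalDeg_ne_zero h.ne') hq
    -- For total degree `n` the power `I ^ (n + 1)` suffices: it lives in degrees above `n`, so the
    -- error `r` has no component in bidegree `q`.
    obtain ⟨s, hs, r, hr, hsr⟩ := Submodule.mem_sup.1 (hI n hbI)
    have hr0 : B.component q r = 0 := B.component_eq_zero_of_mem_degGE
      (by rw [hn]; exact_mod_cast Nat.lt_succ_self n)
      (B.pow_le_degGE (augIdeal_le_degGE hB) n hr)
    rw [← B.component_of_mem hq, ← hsr, map_add, hr0, add_zero]
    exact hS q s hs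

/-- A weak equivalence between connected minimal cbba's is an isomorphism. -/
theorem isIso_of_isWeakEquiv {A : AugCBBA.{u}} {B : AugCBBA.{v}} (hA : A.IsConnected)
    (hB : B.IsConnected) (hAmin : A.IsMinimal) (hBmin : B.IsMinimal)
    {f : Hom A.toCBBA B.toCBBA} (hf : f.IsWeakEquiv) : f.IsIso := by
  have hsurj := surjective_of_isWeakEquiv hB hBmin hf
  -- Once `f` is known to be surjective its kernel is acyclic, so the identity lifts strictly and
  -- not just up to homotopy.
  obtain ⟨g, -, hg⟩ := exists_lift hBmin.1 f ⊤
    ⟨fun _ _ => trivial, fun _ _ => trivial, fun _ _ _ => trivial⟩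
    (fun b => (hsurj b).imp fun a ha => ⟨trivial, ha⟩)
    (fun c _ hc h1 h2 => (hf.exists_of_mem_ker hsurj hc h1 h2).imp fun a ha => ⟨trivial, ha⟩)
    (Hom.id B.toCBBA)
  have hg : ∀ b, f (g b) = b := hg
  have hfg : f.comp g = Hom.id B.toCBBA := Hom.ext hg
  have hgw : g.IsWeakEquiv := hf.of_comp (hfg ▸ Hom.isWeakEquiv_id B.toCBBA)
  refine f.isIso_of_bijective ⟨fun a a' h => ?_, hsurj⟩
  -- The section `g` is a weak equivalence into the connected minimal `A`, hence surjective; since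
  -- `f ∘ g` is the identity, `f` is injective.
  obtain ⟨b, rfl⟩ := surjective_of_isWeakEquiv hA hAmin hgw a
  obtain ⟨b', rfl⟩ := surjective_of_isWeakEquiv hA hAmin hgw a'
  have h : f (g b) = f (g b') := h
  rw [hg, hg] at h
  rw [h]

/-- Lifts up to homotopy between connected minimal models are isomorphisms. -/
lemma exists_isIso {A : CBBA.{w}} {M : AugCBBA.{u}} {N : AugCBBA.{v}} (hM : M.IsConnected)
    (hN : N.IsConnected) {φ : Hom M.toCBBA A} {ψ : Hom N.toCBBA A} (hφ : M.IsMinimalModel φ)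
    (hψ : N.IsMinimalModel ψ) {W : Subalgebra ℂ (tensor Omega A).carrier}
    (hW : A.IsPathSubalgebra W) :
    ∃ f : Hom M.toCBBA N.toCBBA, IsAugHom f ∧ f.IsIso ∧ ∃ H : Hom M.toCBBA (tensor Omega A),
      (∀ m, A.evalTensor 0 (H m) = ψ.comp f m) ∧ (∀ m, A.evalTensor 1 (H m) = φ m) ∧
        ∀ m, H m ∈ W := by
  obtain ⟨f, H, h0, h1, hHW⟩ := exists_homotopy_lift hφ.1.1 hW hψ.2 φ
  simp only [evalPath_eq] at h0 h1
  have hf : f.IsWeakEquiv := hψ.2.of_comp (Homotopic.isWeakEquiv ⟨H, h0, h1⟩ hφ.2)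
  exact ⟨f, isAugHom_of_isConnected hM f, isIso_of_isWeakEquiv hM hN hφ.1 hψ.1 hf, H, h0, h1, hHW⟩

end AugCBBA
end

theorem mainTheorem4 :
    -- a weak equivalence between connected minimal cbba's is an isomorphism
    (∀ (A : AugCBBA.{u}) (B : AugCBBA.{v}), A.IsConnected → B.IsConnected →
      A.IsMinimal → B.IsMinimal →
      ∀ f : CBBA.Hom A.toCBBA B.toCBBA, f.IsWeakEquiv → f.IsIso) ∧
    -- two connected minimal models of a cbba are isomorphic over it
    (∀ (A : CBBA.{w}) (M : AugCBBA.{u}) (N : AugCBBA.{v}), M.IsConnected → N.IsConnected →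
      ∀ (φ : CBBA.Hom M.toCBBA A) (ψ : CBBA.Hom N.toCBBA A),
      M.IsMinimalModel φ → N.IsMinimalModel ψ →
      ∃ f : CBBA.Hom M.toCBBA N.toCBBA, AugCBBA.IsAugHom f ∧ f.IsIso ∧
        CBBA.Homotopic (ψ.comp f) φ) ∧
    -- the same for augmented cbba's
    (∀ (A : AugCBBA.{w}) (M : AugCBBA.{u}) (N : AugCBBA.{v}), M.IsConnected → N.IsConnected →
      ∀ (φ : CBBA.Hom M.toCBBA A.toCBBA) (ψ : CBBA.Hom N.toCBBA A.toCBBA),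
      AugCBBA.IsAugHom φ → AugCBBA.IsAugHom ψ → M.IsMinimalModel φ → N.IsMinimalModel ψ →
      ∃ f : CBBA.Hom M.toCBBA N.toCBBA, AugCBBA.IsAugHom f ∧ f.IsIso ∧
        AugCBBA.AugHomotopic (ψ.comp f) φ) := by
  refine ⟨fun A B hA hB hAmin hBmin f hf => AugCBBA.isIso_of_isWeakEquiv hA hB hAmin hBmin hf,
    fun A M N hM hN φ ψ hφ hψ => ?_, fun A M N hM hN φ ψ _ _ hφ hψ => ?_⟩
  · obtain ⟨f, hf, hiso, H, h0, h1, -⟩ :=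
      AugCBBA.exists_isIso hM hN hφ hψ A.isPathSubalgebra_top
    exact ⟨f, hf, hiso, H, h0, h1⟩
  · obtain ⟨f, hf, hiso, H, h0, h1, hH⟩ :=
      AugCBBA.exists_isIso hM hN hφ hψ (AugCBBA.isPathSubalgebra_pathSubalgebra (A := A))
    -- For `a ∈ M⁺` the path `H a` starts at `ψ (f a)`, which lies in `A⁺`. Membership in `ℂ ⊕ Ω ⊗
    -- A⁺` therefore improves to membership in `Ω ⊗ A⁺`.
    refine ⟨f, hf, hiso, H, h0, h1, fun a ha => AugCBBA.mem_pathSpan (hH a) (s := 0) ?_⟩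
    rw [CBBA.evalPath_eq, h0]
    exact (AugCBBA.augMap_map_of_isConnected hM (ψ.comp f) a).trans ha
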